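/- Theorem 1.2. For complex $s_1,s_2$ with $\Re s_2>1$ and $\Re(s_1+s_2)>2$ let $$\zeta_2(s_1,s_2)=\sum_{m=1}^\infty\frac1{m^{s_1}}\sum_{n=1}^\infty\frac1{(m+n)^{s_2}},$$ and denote also by $\zeta_2$ its meromorphic continuation; let $$\zeta_2^{[2]}(s_1,x)=\sum_{k=2}^\infty\Bigl|\sum_{m=1}^{k-1}\frac1{m^{s_1}}\Bigr|^2\frac1{k^{x}}.$$ Let $s_0=\sigma_0+it_0\in\mathbb C$ with $\sigma_0>1$, and let $\sigma\in\mathbb R$ satisfy $\frac12<\sigma\le1$ and $\sigma_0+\sigma>2$. Then the series $\zeta_2^{[2]}(s_0,2\sigma)$ converges, the function $t\mapsto\zeta_2(s_0,\sigma+it)$ is continuous on $[2,\infty)$, and, as $T\to\infty$, $$\int_2^T|\zeta_2(s_0,\sigma+it)|^2\,dt=\zeta_2^{[2]}(s_0,2\sigma)\,T+O\left(T^{2-2\sigma}\log T\right)+O\left(T^{1/2}\right),$$ where the implied constants may depend on $s_0$ and $\sigma$. -/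

import Mathlib

open Filter Topology Asymptotics

noncomputable section

/-- The Euler double zeta series `∑_{m ≥ 1} m^{-s₁} ∑_{n ≥ 1} (m + n)^{-s₂}`
(the summation indices are shifted by one). -/
def doubleZetaSeries (s₁ s₂ : ℂ) : ℂ :=
  ∑' m : ℕ, 1 / ((m : ℂ) + 1) ^ s₁ * ∑' n : ℕ, 1 / (((m : ℂ) + 1) + ((n : ℂ) + 1)) ^ s₂

/-- The half-plane of those `s₂` for which `(s₁, s₂)` lies in the domain
`Re s₂ > 1`, `Re (s₁ + s₂) > 2` of absolute convergence of the double zeta series. -/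
def doubleZetaHalfPlane (s₁ : ℂ) : Set ℂ :=
  {s₂ | 1 < s₂.re ∧ 2 < (s₁ + s₂).re}

/-- `F` is an analytic continuation, in the second variable, of the double zeta series (with first
variable `s₁`) from its half-plane of absolute convergence to the convex open set `U`. -/
structure IsDoubleZetaContinuation (s₁ : ℂ) (U : Set ℂ) (F : ℂ → ℂ) : Prop where
  isOpen : IsOpen U
  convex : Convex ℝ U
  nonempty_inter : (U ∩ doubleZetaHalfPlane s₁).Nonempty
  differentiableOn : DifferentiableOn ℂ F U
  eqOn : Set.EqOn F (doubleZetaSeries s₁) (U ∩ doubleZetaHalfPlane s₁)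

open Classical in
/-- The Euler double zeta-function `ζ₂(s₁, s₂)`: the value at `s₂` of the analytic continuation of
the double zeta series. As a function of `s₂`, with `s₁` fixed, `ζ₂` is meromorphic on `ℂ`. Its
singularities are isolated, so every regular `s₂` is joined to the half-plane of convergence by a
segment that avoids them, and a small convex neighbourhood of that segment is an admissible `U`.
The value depends neither on `U` nor on `F`, because every admissible `F` agrees on `U` with this
one meromorphic function. (The value is `0` at a pole.) -/
def doubleZeta (s₁ s₂ : ℂ) : ℂ :=
  if h : ∃ w : ℂ, ∃ (U : Set ℂ) (F : ℂ → ℂ),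
      IsDoubleZetaContinuation s₁ U F ∧ s₂ ∈ U ∧ F s₂ = w
  then h.choose else 0

/-- The term `|∑_{m=1}^{k-1} m^{-s₁}|² k^{-x}` of the series `ζ₂^{[2]}(s₁, x)`, for real `x`. -/
def doubleZetaSqTerm (s₁ : ℂ) (x : ℝ) (k : ℕ) : ℝ :=
  ‖∑ m ∈ Finset.Ico 1 k, 1 / (m : ℂ) ^ s₁‖ ^ 2 * (1 / (k : ℝ) ^ x)

/-- `ζ₂^{[2]}(s₁, x) = ∑_{k ≥ 2} |∑_{m=1}^{k-1} m^{-s₁}|² k^{-x}` for real `x`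
(the summation index is shifted by two). -/
def doubleZetaSq (s₁ : ℂ) (x : ℝ) : ℝ :=
  ∑' k : ℕ, doubleZetaSqTerm s₁ x (k + 2)

end

/-!
Write `a k = ∑_{1 ≤ m < k} m ^ (-s₀)`. Since `ζ₂(s₀, s) = ∑ a k * k ^ (-s)` where the series
converges and the `a k` are bounded, the main term is the diagonal of the mean square of the
polynomial `∑_{k < t} a k * k ^ (-s)`, `s = σ + i t`. Two facts are needed.

*Approximation.* `ζ₂(s₀, s)` differs from that polynomial by `O(t ^ (-σ))`
(`exists_norm_doubleZeta_sub_dirichletPoly_le`). Indeed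
`(s - 1) ζ₂(s₀, s) = ∑_m m ^ (-s₀) * zetaTail (m + 1) s`, where `zetaTail k s` continues
`(s - 1) ∑_{n ≥ k} n ^ (-s)`. This series defines a holomorphic function on the half-plane
`re s > max 0 (2 - re s₀)`, including `s = 1`, so the identity theorem on convex sets identifies it
with every admissible continuation (`IsDoubleZetaContinuation.eq_doubleZetaMul_div`). Splitting off
the indices `k < N` turns `zetaTail (m + 1)` into `zetaTail (max (m + 1) N)`. Everything then rests
on the estimate `zetaTail k s = O(k ^ (1 - re s))` for `‖s‖ ≤ (3 / 2) k`
(`exists_norm_zetaTail_le_rpow`), which is obtained in the manner of Kusmin and Landau. The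
difference of `n ^ (-s)` and its integral over `[n, n + 1]` is `n ^ (-s) - (n + 1) ^ (-s)` times a
weight which is expressed by the function `1 / (1 - exp (-w)) - 1 / w`, holomorphic for
`‖w‖ < 2 π`; the weights are thus bounded and of small total variation, and one sums by parts.

*Mean square.* In `∫ |∑_{k < t} a k * k ^ (-σ - i t)|² dt` over `[2, T]` the diagonal gives
`ζ₂^{[2]}(s₀, 2σ) T + O(∑_{k < T} k ^ (1 - 2σ)) + O(T ^ (2 - 2σ))`, and the off-diagonal terms are
bounded one by one through `log (l / k) ≥ (l - k) / l` (`exists_abs_integral_normSq_sub_le`).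

As `σ > 1 / 2`, the error `O(t ^ (-σ))` is square integrable, so that it contributes `O(T ^ (1 / 2))`
through the cross term (`exists_abs_integral_normSq_add_sub_le`).
-/

/-! ### Tails of the Riemann zeta series -/

/-- The integral comparison term `(s - 1) (n ^ (-s) - ∫ u in n..n+1, u ^ (-s))`, in closed form. -/
noncomputable def tailTerm (n : ℕ) (s : ℂ) : ℂ :=
  (s - 1) * (n : ℂ) ^ (-s) - (n : ℂ) ^ (1 - s) + ((n : ℂ) + 1) ^ (1 - s)

/-- The analytic continuation to `0 < re s` of `(s - 1) ∑_{n ≥ k} n ^ (-s)`. The factor `s - 1`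
removes the pole at `1`, so that the function is holomorphic on a convex domain. -/
noncomputable def zetaTail (k : ℕ) (s : ℂ) : ℂ :=
  (k : ℂ) ^ (1 - s) + ∑' j : ℕ, tailTerm (k + j) s

lemma norm_ofReal_cpow_neg_sub_le {a u : ℝ} (ha : 0 < a) (hau : a ≤ u) {s : ℂ} (hs : 0 < s.re) :
    ‖(u : ℂ) ^ (-s) - (a : ℂ) ^ (-s)‖ ≤ ‖s‖ * a ^ (-s.re - 1) * (u - a) := by
  have hs0 : s ≠ 0 := by rintro rfl; simp at hs
  have key : ∀ x ∈ Set.Icc a u, HasDerivWithinAt (fun x : ℝ => (x : ℂ) ^ (-s))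
      (-s * (x : ℂ) ^ (-s - 1)) (Set.Icc a u) x := by
    intro x hx
    exact (hasDerivAt_ofReal_cpow_const (by linarith [hx.1]) (neg_ne_zero.2 hs0)).hasDerivWithinAt
  refine Convex.norm_image_sub_le_of_norm_hasDerivWithin_le (C := ‖s‖ * a ^ (-s.re - 1)) key ?_
    (convex_Icc a u) (Set.left_mem_Icc.2 hau) (Set.right_mem_Icc.2 hau) |>.trans ?_
  · intro x hx
    have hx0 : 0 < x := ha.trans_le hx.1
    rw [norm_mul, norm_neg, Complex.norm_cpow_eq_rpow_re_of_pos hx0]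
    gcongr
    simp only [Complex.sub_re, Complex.neg_re, Complex.one_re]
    exact Real.rpow_le_rpow_of_nonpos ha hx.1 (by linarith)
  · rw [Real.norm_of_nonneg (by linarith)]

lemma norm_tailTerm_le {n : ℕ} (hn : 1 ≤ n) {s : ℂ} (hs : 0 < s.re) :
    ‖tailTerm n s‖ ≤ ‖s - 1‖ * ‖s‖ * (n : ℝ) ^ (-s.re - 1) := by
  have hn0 : (0 : ℝ) < n := by exact_mod_cast hn
  by_cases hs1 : s = 1
  · subst hs1; simp [tailTerm]
  have h1 : (1 : ℂ) - s ≠ 0 := sub_ne_zero.2 (Ne.symm hs1)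
  -- `tailTerm n s` is the increment over `[n, n + 1]` of this function.
  have key : ∀ x ∈ Set.Icc (n : ℝ) (n + 1), HasDerivWithinAt
      (fun x : ℝ => (x : ℂ) ^ (1 - s) + (s - 1) * (n : ℂ) ^ (-s) * x)
      ((1 - s) * ((x : ℂ) ^ (-s) - (n : ℂ) ^ (-s))) (Set.Icc (n : ℝ) (n + 1)) x := by
    intro x hx
    have a1 := hasDerivAt_ofReal_cpow_const (x := x) (by linarith [hx.1]) h1
    have a2 := (Complex.ofRealCLM.hasDerivAt (x := x)).const_mul ((s - 1) * (n : ℂ) ^ (-s))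
    refine ((a1.add a2).congr_deriv ?_).hasDerivWithinAt
    rw [show (1 : ℂ) - s - 1 = -s by ring]
    simp
    ring
  have := Convex.norm_image_sub_le_of_norm_hasDerivWithin_le
    (C := ‖s - 1‖ * (‖s‖ * (n : ℝ) ^ (-s.re - 1))) key ?_
    (convex_Icc _ _) (Set.left_mem_Icc.2 (by linarith)) (Set.right_mem_Icc.2 (by linarith))
  · convert this using 1
    · congr 1
      push_cast
      simp only [tailTerm]
      ring
    · simp [mul_assoc]
  · intro x hx
    rw [norm_mul, norm_sub_rev 1 s]
    gcongr
    have := norm_ofReal_cpow_neg_sub_le hn0 hx.1 hs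
    push_cast at this
    refine this.trans ?_
    exact mul_le_of_le_one_right (by positivity) (by linarith [hx.2])

lemma summable_tailTerm {k : ℕ} (hk : 1 ≤ k) {s : ℂ} (hs : 0 < s.re) :
    Summable fun j : ℕ => tailTerm (k + j) s := by
  have h : Summable fun n : ℕ => (n : ℝ) ^ (-s.re - 1) :=
    Real.summable_nat_rpow.2 (by linarith)
  have h' : Summable fun j : ℕ => ‖s - 1‖ * ‖s‖ * ((j + k : ℕ) : ℝ) ^ (-s.re - 1) :=
    ((summable_nat_add_iff k).2 h).mul_left _
  refine Summable.of_norm_bounded h' fun j => ?_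
  rw [add_comm k j]
  exact norm_tailTerm_le (by omega) hs

lemma zetaTail_eq_add {k : ℕ} (hk : 1 ≤ k) {s : ℂ} (hs : 0 < s.re) :
    zetaTail k s = (s - 1) * (k : ℂ) ^ (-s) + zetaTail (k + 1) s := by
  have h := (summable_tailTerm hk hs).tsum_eq_zero_add
  simp only [zetaTail, h, add_zero]
  have : (fun j => tailTerm (k + (j + 1)) s) = fun j => tailTerm (k + 1 + j) s := by
    funext j; congr 1; omega
  rw [this]
  simp only [tailTerm]
  push_cast
  ring

lemma zetaTail_eq_sum_add {k N : ℕ} (hk : 1 ≤ k) (hN : k ≤ N) {s : ℂ} (hs : 0 < s.re) :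
    zetaTail k s = (s - 1) * ∑ n ∈ Finset.Ico k N, (n : ℂ) ^ (-s) + zetaTail N s := by
  induction N, hN using Nat.le_induction with
  | base => simp
  | succ N hN ih =>
    rw [ih, Finset.sum_Ico_succ_top hN, zetaTail_eq_add (hk.trans hN) hs]
    ring

lemma tendsto_zetaTail_zero {s : ℂ} (hs : 1 < s.re) :
    Tendsto (fun N => zetaTail N s) atTop (𝓝 0) := by
  have h1 : Tendsto (fun N : ℕ => (N : ℂ) ^ (1 - s)) atTop (𝓝 0) := by
    rw [tendsto_zero_iff_norm_tendsto_zero]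
    have : Tendsto (fun N : ℕ => (N : ℝ) ^ (-(s.re - 1))) atTop (𝓝 0) :=
      (tendsto_rpow_neg_atTop (by linarith)).comp tendsto_natCast_atTop_atTop
    refine this.congr' ?_
    filter_upwards [eventually_gt_atTop 0] with N hN
    rw [Complex.norm_natCast_cpow_of_pos hN]
    simp
  have h2 := tendsto_sum_nat_add fun j => tailTerm j s
  have h3 := h1.add h2
  simp only [add_zero] at h3
  refine h3.congr fun N => ?_
  simp only [zetaTail, add_comm N]

lemma hasSum_zetaTail {k : ℕ} (hk : 1 ≤ k) {s : ℂ} (hs : 1 < s.re) :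
    HasSum (fun j : ℕ => ((k + j : ℕ) : ℂ) ^ (-s)) (zetaTail k s / (s - 1)) := by
  have hs1 : s - 1 ≠ 0 := fun h => by simp [sub_eq_zero.1 h] at hs
  have hsum : Summable (fun j : ℕ => ((k + j : ℕ) : ℂ) ^ (-s)) := by
    have h0 : Summable fun n : ℕ => (n : ℂ) ^ (-s) := by
      simpa [Complex.cpow_neg] using Complex.summable_one_div_nat_cpow.2 hs
    simpa only [add_comm] using (summable_nat_add_iff k).2 h0
  rw [hsum.hasSum_iff_tendsto_nat]
  have h2 : Tendsto (fun N => zetaTail (k + N) s) atTop (𝓝 0) := by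
    simpa only [add_comm] using (tendsto_add_atTop_iff_nat k).2 (tendsto_zetaTail_zero hs)
  have h3 : Tendsto (fun N => (zetaTail k s - zetaTail (k + N) s) / (s - 1)) atTop
      (𝓝 ((zetaTail k s - 0) / (s - 1))) := (tendsto_const_nhds.sub h2).div_const _
  rw [sub_zero] at h3
  refine h3.congr fun N => ?_
  rw [zetaTail_eq_sum_add hk (Nat.le_add_right k N) (by linarith : 0 < s.re),
    Finset.sum_Ico_eq_sum_range]
  simp only [Nat.add_sub_cancel_left]
  field_simp
  ring

/-- A bound that is locally uniform in `s`, for convergence and holomorphy. -/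
lemma exists_norm_zetaTail_le {α : ℝ} (hα : 0 < α) (hα1 : α ≤ 1) (R : ℝ) :
    ∃ C : ℝ, 0 ≤ C ∧ ∀ (k : ℕ) (s : ℂ), 1 ≤ k → α < s.re → ‖s‖ < R →
      ‖zetaTail k s‖ ≤ C * (k : ℝ) ^ (1 - α) := by
  have hsum : Summable fun n : ℕ => (n : ℝ) ^ (-α - 1) := Real.summable_nat_rpow.2 (by linarith)
  set Z : ℝ := ∑' n : ℕ, (n : ℝ) ^ (-α - 1)
  have hZ : 0 ≤ Z := tsum_nonneg fun n => by positivity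
  refine ⟨1 + (|R| + 1) * |R| * Z, by positivity, fun k s hk hs hR => ?_⟩
  have hR' : ‖s‖ ≤ |R| := hR.le.trans (le_abs_self R)
  have hk0 : (0 : ℝ) < k := by exact_mod_cast hk
  have hk1 : (1 : ℝ) ≤ k := by exact_mod_cast hk
  have h1 : (1 : ℝ) ≤ (k : ℝ) ^ (1 - α) := Real.one_le_rpow hk1 (by linarith)
  have h2 : ‖(k : ℂ) ^ (1 - s)‖ ≤ (k : ℝ) ^ (1 - α) := by
    rw [Complex.norm_natCast_cpow_of_pos (by omega)]
    exact Real.rpow_le_rpow_of_exponent_le hk1 (by simp; linarith)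
  have h3 : ∀ j, ‖tailTerm (k + j) s‖ ≤ (|R| + 1) * |R| * ((j + k : ℕ) : ℝ) ^ (-α - 1) := by
    intro j
    rw [add_comm k j]
    refine (norm_tailTerm_le (by omega) (by linarith)).trans ?_
    have : ‖s - 1‖ ≤ |R| + 1 := (norm_sub_le _ _).trans (by simpa using hR')
    gcongr
    exact_mod_cast (by omega : 1 ≤ j + k)
  have h4 : ∑' j : ℕ, ((j + k : ℕ) : ℝ) ^ (-α - 1) ≤ Z := by
    have hZ' := hsum.sum_add_tsum_nat_add k
    have : 0 ≤ ∑ i ∈ Finset.range k, (i : ℝ) ^ (-α - 1) :=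
      Finset.sum_nonneg fun i _ => by positivity
    linarith
  have h5 : ‖∑' j : ℕ, tailTerm (k + j) s‖ ≤ (|R| + 1) * |R| * Z := by
    refine (tsum_of_norm_bounded
      (((summable_nat_add_iff k).2 hsum).mul_left ((|R| + 1) * |R|)).hasSum h3).trans ?_
    rw [tsum_mul_left]
    gcongr
  calc ‖zetaTail k s‖ ≤ (k : ℝ) ^ (1 - α) + (|R| + 1) * |R| * Z :=
        (norm_add_le _ _).trans (add_le_add h2 h5)
    _ ≤ (k : ℝ) ^ (1 - α) + (|R| + 1) * |R| * Z * (k : ℝ) ^ (1 - α) := by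
        exact add_le_add le_rfl (le_mul_of_one_le_right (by positivity) h1)
    _ = _ := by ring

lemma isOpen_re_gt_inter_ball (α R : ℝ) : IsOpen {s : ℂ | α < s.re ∧ ‖s‖ < R} :=
  (isOpen_lt continuous_const Complex.continuous_re).inter
    (isOpen_lt continuous_norm continuous_const)

lemma differentiableOn_zetaTail {k : ℕ} (hk : 1 ≤ k) {α : ℝ} (hα : 0 < α) (R : ℝ) :
    DifferentiableOn ℂ (zetaTail k) {s | α < s.re ∧ ‖s‖ < R} := by
  have hc : ∀ m : ℕ, 1 ≤ m → (m : ℂ) ≠ 0 := fun m hm => by exact_mod_cast (by omega : m ≠ 0)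
  have hd : ∀ (m : ℕ) (hm : 1 ≤ m), Differentiable ℂ fun s : ℂ => (m : ℂ) ^ (1 - s) := fun m hm =>
    (differentiable_id.const_sub 1).const_cpow (Or.inl (hc m hm))
  refine (hd k hk).differentiableOn.add ?_
  have hsum : Summable fun n : ℕ => (n : ℝ) ^ (-α - 1) := Real.summable_nat_rpow.2 (by linarith)
  refine Complex.differentiableOn_tsum_of_summable_norm
    (u := fun j => (|R| + 1) * |R| * ((j + k : ℕ) : ℝ) ^ (-α - 1))
    (((summable_nat_add_iff k).2 hsum).mul_left _) (fun j => ?_) (isOpen_re_gt_inter_ball α R) ?_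
  · have h1 := hd (k + j) (by omega)
    have h2 := hd (k + j + 1) (by omega)
    have h3 : Differentiable ℂ fun s : ℂ => ((k + j : ℕ) : ℂ) ^ (-s) :=
      differentiable_id.neg.const_cpow (Or.inl (hc _ (by omega)))
    have h4 := (((differentiable_id.sub_const (1 : ℂ)).mul h3).sub h1).add h2
    refine h4.differentiableOn.congr fun s _ => ?_
    simp [tailTerm]
  · rintro j s ⟨hs, hR⟩
    have hR' : ‖s‖ ≤ |R| := hR.le.trans (le_abs_self R)
    rw [add_comm k j]
    refine (norm_tailTerm_le (by omega) (by linarith)).trans ?_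
    have : ‖s - 1‖ ≤ |R| + 1 := (norm_sub_le _ _).trans (by simpa using hR')
    gcongr
    exact_mod_cast (by omega : 1 ≤ j + k)

/-! ### The tail estimate -/

/-- The holomorphic part at `0` of `1 / (1 - exp (-w))`, away from the removable singularity. -/
noncomputable def todd (w : ℂ) : ℂ := 1 / (1 - Complex.exp (-w)) - 1 / w

lemma one_sub_exp_neg_ne_zero {w : ℂ} (hw : w ≠ 0) (hw2 : ‖w‖ < 2) :
    1 - Complex.exp (-w) ≠ 0 := by
  intro h
  obtain ⟨n, hn⟩ := Complex.exp_eq_one_iff.1 (sub_eq_zero.1 h).symm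
  have hn0 : n ≠ 0 := by rintro rfl; simp at hn; exact hw hn
  have h1 : ‖w‖ = |(n : ℝ)| * (2 * Real.pi) := by
    rw [← norm_neg, hn]
    simp [abs_of_pos Real.pi_pos]
  have h2 : (1 : ℝ) ≤ |(n : ℝ)| := by exact_mod_cast Int.one_le_abs hn0
  nlinarith [Real.pi_gt_three]

/-- On a disc of radius less than `2 * π`, `todd` extends holomorphically across `0`, so it is
bounded and Lipschitz on smaller discs. -/
lemma exists_todd_bound : ∃ K : ℝ, 0 ≤ K ∧ ∀ w : ℂ, w ≠ 0 → ‖w‖ ≤ 3 / 2 → ‖todd w‖ ≤ K ∧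
    ∀ w' : ℂ, w' ≠ 0 → ‖w'‖ ≤ 3 / 2 → ‖todd w - todd w'‖ ≤ K * ‖w - w'‖ := by
  set f : ℂ → ℂ := fun w => 1 - Complex.exp (-w) with hf
  have hfd : Differentiable ℂ f := by fun_prop
  have hf0 : f 0 = 0 := by simp [hf]
  have hf' : deriv f 0 = 1 := by
    have : HasDerivAt f (-(Complex.exp (-0) * -1)) 0 :=
      ((hasDerivAt_neg (0 : ℂ)).cexp).const_sub 1
    simpa using this.deriv
  set B : ℂ → ℂ := dslope f 0 with hB
  have hBd : Differentiable ℂ B := by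
    rw [← differentiableOn_univ, Complex.differentiableOn_dslope Filter.univ_mem]
    exact hfd.differentiableOn
  have hB0 : B 0 = 1 := by rw [hB, dslope_same, hf']
  have hBne : ∀ w, w ≠ 0 → B w = f w / w := fun w hw => by
    rw [hB, dslope_of_ne _ hw, slope_def_field, hf0, sub_zero, sub_zero]
  set g : ℂ → ℂ := fun w => 1 - B w with hg
  have hgd : Differentiable ℂ g := by fun_prop
  set A : ℂ → ℂ := dslope g 0 with hA
  have hAd : Differentiable ℂ A := by
    rw [← differentiableOn_univ, Complex.differentiableOn_dslope Filter.univ_mem]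
    exact hgd.differentiableOn
  have hAne : ∀ w, w ≠ 0 → A w = (1 - f w / w) / w := fun w hw => by
    rw [hA, dslope_of_ne _ hw, slope_def_field]
    simp only [hg, hB0, hBne w hw, sub_self, sub_zero]
  set F : ℂ → ℂ := fun w => A w / B w with hF
  have hFt : ∀ w, w ≠ 0 → ‖w‖ < 2 → F w = todd w := fun w hw hw2 => by
    have h1 := one_sub_exp_neg_ne_zero hw hw2
    have h2 : f w ≠ 0 := h1
    simp only [hF, hAne w hw, hBne w hw, todd]
    rw [← show f w = 1 - Complex.exp (-w) from rfl]
    field_simp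
  have hFd : DifferentiableOn ℂ F (Metric.ball 0 2) := by
    refine hAd.differentiableOn.div hBd.differentiableOn fun w hw => ?_
    by_cases hw0 : w = 0
    · rw [hw0, hB0]; exact one_ne_zero
    · rw [hBne w hw0]
      exact div_ne_zero (one_sub_exp_neg_ne_zero hw0 (by simpa using hw)) hw0
  have hsub : Metric.closedBall (0 : ℂ) (3 / 2) ⊆ Metric.ball 0 2 :=
    Metric.closedBall_subset_ball (by norm_num)
  have hcpt := isCompact_closedBall (0 : ℂ) (3 / 2)
  obtain ⟨K₁, hK₁⟩ := hcpt.exists_bound_of_continuousOn (hFd.continuousOn.mono hsub)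
  obtain ⟨K₂, hK₂⟩ := hcpt.exists_bound_of_continuousOn
    ((hFd.deriv Metric.isOpen_ball).continuousOn.mono hsub)
  refine ⟨max 0 (max K₁ K₂), le_max_left _ _, fun w hw hw2 => ⟨?_, fun w' hw' hw2' => ?_⟩⟩
  · rw [← hFt w hw (by linarith)]
    exact (hK₁ w (by simpa using hw2)).trans ((le_max_left _ _).trans (le_max_right _ _))
  · rw [← hFt w hw (by linarith), ← hFt w' hw' (by linarith)]
    refine Convex.norm_image_sub_le_of_norm_deriv_le (s := Metric.closedBall (0 : ℂ) (3 / 2))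
      (fun x hx => hFd.differentiableAt (Metric.isOpen_ball.mem_nhds (hsub hx)))
      (fun x hx => (hK₂ x hx).trans ((le_max_right _ _).trans (le_max_right _ _)))
      (convex_closedBall _ _) (by simpa using hw2') (by simpa using hw2)

/-- `log (1 + 1 / n)`. -/
noncomputable def logStep (n : ℕ) : ℝ := Real.log (1 + 1 / n)

lemma logStep_pos {n : ℕ} (hn : 1 ≤ n) : 0 < logStep n := by
  have : (0 : ℝ) < n := by exact_mod_cast hn
  exact Real.log_pos (by simp; linarith)

lemma logStep_le {n : ℕ} (hn : 1 ≤ n) : logStep n ≤ 1 / n := by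
  have : (0 : ℝ) < n := by exact_mod_cast hn
  exact (Real.log_le_sub_one_of_pos (by positivity)).trans (by simp)

lemma logStep_succ_le {n : ℕ} (hn : 1 ≤ n) : logStep (n + 1) ≤ logStep n := by
  have : (0 : ℝ) < n := by exact_mod_cast hn
  unfold logStep
  gcongr
  simp

/-- The Kusmin–Landau weight: `tailTerm n s` is `stepWeight n s` times the increment
`n ^ (-s) - (n + 1) ^ (-s)`. -/
noncomputable def stepWeight (n : ℕ) (s : ℂ) : ℂ :=
  s * todd (s * logStep n) - todd (logStep n)

lemma natCast_add_one_cpow {n : ℕ} (hn : 1 ≤ n) (s : ℂ) :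
    ((n : ℂ) + 1) ^ (-s) = (n : ℂ) ^ (-s) * Complex.exp (-(s * logStep n)) := by
  have hn0 : (0 : ℝ) < n := by exact_mod_cast hn
  have h1 : ((n : ℂ) + 1) = ((n : ℝ) : ℂ) * ((1 + 1 / n : ℝ) : ℂ) := by
    rw [← Complex.ofReal_mul]
    have : (n : ℝ) * (1 + 1 / n) = n + 1 := by field_simp
    rw [this]; simp
  rw [h1, Complex.mul_cpow_ofReal_nonneg hn0.le (by positivity)]
  congr 1
  rw [Complex.cpow_def_of_ne_zero (by exact_mod_cast (by positivity : (1 + 1 / n : ℝ) ≠ 0)),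
    ← Complex.ofReal_log (by positivity)]
  congr 1
  simp only [logStep]
  ring

lemma tailTerm_eq_mul_stepWeight {n : ℕ} (hn : 1 ≤ n) {s : ℂ} (hs : s ≠ 0)
    (hsn : ‖s‖ ≤ 3 / 2 * n) :
    tailTerm n s = ((n : ℂ) ^ (-s) - ((n : ℂ) + 1) ^ (-s)) * stepWeight n s := by
  have hn0 : (0 : ℝ) < n := by exact_mod_cast hn
  have hnc : (n : ℂ) ≠ 0 := by exact_mod_cast hn0.ne'
  have hnc1 : (n : ℂ) + 1 ≠ 0 := by exact_mod_cast (by positivity : (n : ℝ) + 1 ≠ 0)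
  have hL := logStep_pos hn
  have hLc : (logStep n : ℂ) ≠ 0 := by exact_mod_cast hL.ne'
  have hw : ‖s * logStep n‖ < 2 := by
    rw [norm_mul, Complex.norm_real, Real.norm_of_nonneg hL.le]
    calc ‖s‖ * logStep n ≤ (3 / 2 * n) * (1 / n) := by
          gcongr
          exact logStep_le hn
      _ < 2 := by field_simp; norm_num
  have hq := one_sub_exp_neg_ne_zero (mul_ne_zero hs hLc) hw
  have hexp : 1 - Complex.exp (-(logStep n : ℂ)) = 1 / ((n : ℂ) + 1) := by
    rw [← Complex.ofReal_neg, ← Complex.ofReal_exp, logStep, Real.exp_neg,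
      Real.exp_log (by positivity)]
    push_cast
    have : (1 : ℂ) + 1 / n = (n + 1) / n := by field_simp
    rw [this]
    field_simp
    ring
  have h1 : (n : ℂ) ^ (1 - s) = n * (n : ℂ) ^ (-s) := by
    rw [sub_eq_add_neg, Complex.cpow_add _ _ hnc, Complex.cpow_one]
  have h2 : ((n : ℂ) + 1) ^ (1 - s) = (n + 1) * ((n : ℂ) + 1) ^ (-s) := by
    rw [sub_eq_add_neg, Complex.cpow_add _ _ hnc1, Complex.cpow_one]
  rw [tailTerm, h1, h2, natCast_add_one_cpow hn, stepWeight, todd, todd, hexp]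
  set q := Complex.exp (-(s * logStep n))
  field_simp
  ring

/-- Summation by parts against weights `E n` of total variation controlled by a decreasing
sequence `L`. -/
lemma norm_sum_sub_mul_le {z E : ℕ → ℂ} {L : ℕ → ℝ} {k : ℕ} {Z M V : ℝ}
    (hV : 0 ≤ V) (hz : ∀ n, k ≤ n → ‖z n‖ ≤ Z) (hE : ∀ n, k ≤ n → ‖E n‖ ≤ M)
    (hEL : ∀ n, k ≤ n → ‖E n - E (n + 1)‖ ≤ V * (L n - L (n + 1))) (hL : ∀ n, k ≤ n → 0 ≤ L n)
    (J : ℕ) :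
    ‖∑ j ∈ Finset.range J, (z (k + j) - z (k + j + 1)) * E (k + j)‖
      ≤ 2 * Z * M + Z * V * L k := by
  have hZ : 0 ≤ Z := (norm_nonneg _).trans (hz k le_rfl)
  have habel : ∀ J, ∑ j ∈ Finset.range J, (z (k + j) - z (k + j + 1)) * E (k + j)
      = z k * E k - z (k + J) * E (k + J)
        - ∑ j ∈ Finset.range J, z (k + j + 1) * (E (k + j) - E (k + j + 1)) := by
    intro J
    induction J with
    | zero => simp
    | succ J ih =>
      rw [Finset.sum_range_succ, Finset.sum_range_succ, ih, ← add_assoc]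
      ring
  have htel : ∑ j ∈ Finset.range J, Z * (V * (L (k + j) - L (k + j + 1)))
      = Z * (V * (L k - L (k + J))) := by
    rw [← Finset.mul_sum, ← Finset.mul_sum]
    congr 2
    exact Finset.sum_range_sub' (fun j => L (k + j)) J
  have h1 : ‖∑ j ∈ Finset.range J, z (k + j + 1) * (E (k + j) - E (k + j + 1))‖
      ≤ Z * V * L k := by
    refine (norm_sum_le_of_le _ fun j _ => ?_).trans (htel.le.trans ?_)
    · rw [norm_mul]
      exact mul_le_mul (hz _ (by omega)) (hEL _ (by omega)) (norm_nonneg _) hZ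
    · rw [mul_assoc]
      gcongr
      linarith [hL (k + J) (by omega)]
  have h2 : ∀ n, k ≤ n → ‖z n * E n‖ ≤ Z * M := fun n hn => by
    rw [norm_mul]
    exact mul_le_mul (hz n hn) (hE n hn) (norm_nonneg _) hZ
  rw [habel]
  calc _ ≤ ‖z k * E k‖ + ‖z (k + J) * E (k + J)‖ + _ :=
        (norm_sub_le _ _).trans (add_le_add (norm_sub_le _ _) le_rfl)
    _ ≤ Z * M + Z * M + Z * V * L k := by
        gcongr
        · exact h2 _ le_rfl
        · exact h2 _ (by omega)
    _ = _ := by ring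

/-- The tail of the zeta series from `k` on is of the order of the integral that it
approximates, as soon as the frequencies `‖s‖ / n`, `n ≥ k`, stay away from `2 * π`. -/
lemma exists_norm_zetaTail_le_rpow : ∃ C : ℝ, 0 ≤ C ∧ ∀ (k : ℕ) (s : ℂ), 1 ≤ k → 0 < s.re →
    ‖s‖ ≤ 3 / 2 * k → ‖zetaTail k s‖ ≤ C * (k : ℝ) ^ (1 - s.re) := by
  obtain ⟨K, hK0, hK⟩ := exists_todd_bound
  refine ⟨1 + 10 * K, by positivity, fun k s hk hs hsk => ?_⟩
  have hs0 : s ≠ 0 := by rintro rfl; simp at hs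
  have hk0 : (0 : ℝ) < k := by exact_mod_cast hk
  have hk1 : (1 : ℝ) ≤ k := by exact_mod_cast hk
  have hsn : ∀ n : ℕ, k ≤ n → ‖s‖ ≤ 3 / 2 * n := fun n hn =>
    hsk.trans (by gcongr)
  have hLn : ∀ n : ℕ, k ≤ n → (logStep n : ℂ) ≠ 0 ∧ ‖(logStep n : ℂ)‖ ≤ 3 / 2 := by
    intro n hn
    have h0 := logStep_pos (hk.trans hn)
    have hn0 : (1 : ℝ) ≤ n := by exact_mod_cast hk.trans hn
    refine ⟨by exact_mod_cast h0.ne', ?_⟩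
    rw [Complex.norm_real, Real.norm_of_nonneg h0.le]
    refine (logStep_le (hk.trans hn)).trans ?_
    rw [div_le_iff₀ (by linarith)]; linarith
  have hsL : ∀ n : ℕ, k ≤ n → s * (logStep n : ℂ) ≠ 0 ∧ ‖s * (logStep n : ℂ)‖ ≤ 3 / 2 := by
    intro n hn
    have h0 := logStep_pos (hk.trans hn)
    have hn0 : (0 : ℝ) < n := by exact_mod_cast hk.trans hn
    refine ⟨mul_ne_zero hs0 (hLn n hn).1, ?_⟩
    rw [norm_mul, Complex.norm_real, Real.norm_of_nonneg h0.le]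
    calc ‖s‖ * logStep n ≤ (3 / 2 * n) * (1 / n) := by
          gcongr
          · exact hsn n hn
          · exact logStep_le (hk.trans hn)
      _ = 3 / 2 := by field_simp
  have hterm : ∀ j, tailTerm (k + j) s
      = (((k + j : ℕ) : ℂ) ^ (-s) - ((k + j + 1 : ℕ) : ℂ) ^ (-s)) * stepWeight (k + j) s := by
    intro j
    rw [tailTerm_eq_mul_stepWeight (by omega) hs0 (hsn _ (by omega))]
    push_cast
    rfl
  have hpart : ∀ J, ‖∑ j ∈ Finset.range J, tailTerm (k + j) s‖
      ≤ 10 * K * (k : ℝ) ^ (1 - s.re) := by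
    intro J
    simp only [hterm]
    refine (norm_sum_sub_mul_le (z := fun n => (n : ℂ) ^ (-s)) (E := fun n => stepWeight n s)
      (L := logStep) (Z := (k : ℝ) ^ (-s.re)) (M := K * (‖s‖ + 1)) (V := K * (‖s‖ ^ 2 + 1))
      (by positivity) ?_ ?_ ?_ ?_ J).trans ?_
    · intro n hn
      rw [Complex.norm_natCast_cpow_of_pos (by omega)]
      exact Real.rpow_le_rpow_of_nonpos hk0 (by exact_mod_cast hn) (by simpa using hs.le)
    · intro n hn
      calc ‖stepWeight n s‖ ≤ ‖s‖ * K + K := by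
            refine (norm_sub_le _ _).trans (add_le_add ?_ (hK _ (hLn n hn).1 (hLn n hn).2).1)
            rw [norm_mul]
            gcongr
            exact (hK _ (hsL n hn).1 (hsL n hn).2).1
        _ = _ := by ring
    · intro n hn
      have hn' : k ≤ n + 1 := by omega
      have hd := logStep_succ_le (hk.trans hn)
      have e : stepWeight n s - stepWeight (n + 1) s
          = s * (todd (s * logStep n) - todd (s * logStep (n + 1)))
            - (todd (logStep n) - todd (logStep (n + 1))) := by
        simp only [stepWeight]; ring
      have h1 := (hK _ (hsL n hn).1 (hsL n hn).2).2 _ (hsL _ hn').1 (hsL _ hn').2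
      have h2 := (hK _ (hLn n hn).1 (hLn n hn).2).2 _ (hLn _ hn').1 (hLn _ hn').2
      have e2 : ‖(logStep n : ℂ) - logStep (n + 1)‖ = logStep n - logStep (n + 1) := by
        rw [← Complex.ofReal_sub, Complex.norm_real, Real.norm_of_nonneg (by linarith)]
      rw [← mul_sub, norm_mul, e2] at h1
      rw [e2] at h2
      rw [e]
      calc _ ≤ ‖s‖ * (K * (‖s‖ * (logStep n - logStep (n + 1))))
              + K * (logStep n - logStep (n + 1)) := by
            refine (norm_sub_le _ _).trans (add_le_add ?_ h2)
            rw [norm_mul]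
            gcongr
        _ = _ := by ring
    · exact fun n hn => (logStep_pos (hk.trans hn)).le
    · have hpow : (k : ℝ) ^ (1 - s.re) = k * (k : ℝ) ^ (-s.re) := by
        rw [sub_eq_add_neg, Real.rpow_add hk0, Real.rpow_one]
      have hP : 0 ≤ (k : ℝ) ^ (-s.re) := by positivity
      have h1 : ‖s‖ + 1 ≤ 5 / 2 * k := by linarith
      have h2 : (‖s‖ ^ 2 + 1) * logStep k ≤ 13 / 4 * k := by
        calc (‖s‖ ^ 2 + 1) * logStep k ≤ ((3 / 2 * k) ^ 2 + k ^ 2) * (1 / k) := by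
              have : (1 : ℝ) ≤ (k : ℝ) ^ 2 := one_le_pow₀ hk1
              gcongr
              · exact (logStep_pos hk).le
              · exact logStep_le hk
          _ = _ := by field_simp; ring
      rw [hpow]
      calc _ = (k : ℝ) ^ (-s.re) * K * (2 * (‖s‖ + 1) + (‖s‖ ^ 2 + 1) * logStep k) := by ring
        _ ≤ (k : ℝ) ^ (-s.re) * K * (2 * (5 / 2 * k) + 13 / 4 * k) := by gcongr
        _ ≤ (k : ℝ) ^ (-s.re) * K * (10 * k) := by gcongr; linarith
        _ = _ := by ring
  have hlim : ‖∑' j, tailTerm (k + j) s‖ ≤ 10 * K * (k : ℝ) ^ (1 - s.re) :=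
    le_of_tendsto (summable_tailTerm hk hs).hasSum.tendsto_sum_nat.norm
      (Eventually.of_forall hpart)
  calc ‖zetaTail k s‖ ≤ ‖(k : ℂ) ^ (1 - s)‖ + _ := norm_add_le _ _
    _ ≤ (k : ℝ) ^ (1 - s.re) + 10 * K * (k : ℝ) ^ (1 - s.re) := by
        gcongr
        rw [Complex.norm_natCast_cpow_of_pos (by omega)]
        simp
    _ = _ := by ring

/-! ### The continued double zeta function -/

/-- The analytic continuation of `(s - 1) * ζ₂(s₀, s)` to `2 - re s₀ < re s`, `0 < re s`. -/
noncomputable def doubleZetaMul (s₀ s : ℂ) : ℂ :=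
  ∑' m : ℕ, 1 / ((m : ℂ) + 1) ^ s₀ * zetaTail (m + 2) s

lemma norm_one_div_add_one_cpow (m : ℕ) (s₀ : ℂ) :
    ‖1 / ((m : ℂ) + 1) ^ s₀‖ = ((m : ℝ) + 1) ^ (-s₀.re) := by
  have := Complex.norm_natCast_cpow_of_pos (Nat.succ_pos m) s₀
  push_cast at this
  rw [norm_div, norm_one, this, Real.rpow_neg (by positivity), one_div]

lemma summable_add_one_rpow_mul_add_two_rpow {a α : ℝ} (hα1 : α ≤ 1) (h : 2 < a + α) :
    Summable fun m : ℕ => ((m : ℝ) + 1) ^ (-a) * ((m : ℝ) + 2) ^ (1 - α) := by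
  have h1 : Summable fun m : ℕ => ((m : ℝ)) ^ (1 - α - a) :=
    Real.summable_nat_rpow.2 (by linarith)
  have h2 := ((summable_nat_add_iff 1).2 h1).mul_left ((2 : ℝ) ^ (1 - α))
  refine Summable.of_nonneg_of_le (fun m => by positivity) (fun m => ?_) h2
  have h3 : ((m : ℝ) + 2) ^ (1 - α) ≤ (2 * ((m : ℝ) + 1)) ^ (1 - α) :=
    Real.rpow_le_rpow (by positivity) (by linarith [(Nat.cast_nonneg m : (0 : ℝ) ≤ m)])
      (by linarith)
  rw [Real.mul_rpow (by norm_num) (by positivity)] at h3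
  push_cast
  calc _ ≤ ((m : ℝ) + 1) ^ (-a) * (2 ^ (1 - α) * ((m : ℝ) + 1) ^ (1 - α)) := by gcongr
    _ = 2 ^ (1 - α) * ((m : ℝ) + 1) ^ (1 - α - a) := by
      rw [sub_eq_add_neg (1 - α) a, Real.rpow_add (by positivity)]; ring

section Continuation

variable {s₀ : ℂ} {α : ℝ}

lemma exists_norm_weight_mul_zetaTail_le (hα : 0 < α) (hα1 : α ≤ 1) (R : ℝ) :
    ∃ C : ℝ, 0 ≤ C ∧ ∀ (N m : ℕ) (s : ℂ), α < s.re → ‖s‖ < R →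
      ‖1 / ((m : ℂ) + 1) ^ s₀ * zetaTail (max (m + 2) N) s‖
        ≤ C * (max 1 N : ℕ) ^ (1 - α) * (((m : ℝ) + 1) ^ (-s₀.re) * ((m : ℝ) + 2) ^ (1 - α)) := by
  obtain ⟨C, hC0, hC⟩ := exists_norm_zetaTail_le hα hα1 R
  refine ⟨C, hC0, fun N m s hs hR => ?_⟩
  rw [norm_mul, norm_one_div_add_one_cpow]
  have h1 := hC (max (m + 2) N) s (by omega) hs hR
  have h2 : ((max (m + 2) N : ℕ) : ℝ) ^ (1 - α)
      ≤ ((max 1 N : ℕ) : ℝ) ^ (1 - α) * ((m : ℝ) + 2) ^ (1 - α) := by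
    rw [← Real.mul_rpow (by positivity) (by positivity)]
    refine Real.rpow_le_rpow (by positivity) ?_ (by linarith)
    have : max (m + 2) N ≤ max 1 N * (m + 2) := by
      refine max_le (Nat.le_mul_of_pos_left _ (by omega)) ?_
      exact (le_max_right 1 N).trans (Nat.le_mul_of_pos_right _ (by omega))
    exact_mod_cast this
  calc _ ≤ ((m : ℝ) + 1) ^ (-s₀.re)
        * (C * (((max 1 N : ℕ) : ℝ) ^ (1 - α) * ((m : ℝ) + 2) ^ (1 - α))) := by
        refine mul_le_mul_of_nonneg_left (h1.trans ?_) (by positivity)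
        gcongr
    _ = _ := by ring

lemma summable_weight_mul_zetaTail (hα : 0 < α) (hα1 : α ≤ 1) (h : 2 < s₀.re + α) (N : ℕ)
    {s : ℂ} (hs : α < s.re) :
    Summable fun m : ℕ => 1 / ((m : ℂ) + 1) ^ s₀ * zetaTail (max (m + 2) N) s := by
  obtain ⟨C, -, hC⟩ := exists_norm_weight_mul_zetaTail_le (s₀ := s₀) hα hα1 (‖s‖ + 1)
  exact Summable.of_norm_bounded
    ((summable_add_one_rpow_mul_add_two_rpow hα1 h).mul_left _)
    fun m => hC N m s hs (by linarith)

lemma differentiableOn_doubleZetaMul (hα : 0 < α) (hα1 : α ≤ 1) (h : 2 < s₀.re + α) :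
    DifferentiableOn ℂ (doubleZetaMul s₀) {s | α < s.re} := by
  intro s hs
  obtain ⟨C, -, hC⟩ := exists_norm_weight_mul_zetaTail_le (s₀ := s₀) hα hα1 (‖s‖ + 1)
  have hopen := isOpen_re_gt_inter_ball α (‖s‖ + 1)
  have hd : DifferentiableOn ℂ (doubleZetaMul s₀) {z | α < z.re ∧ ‖z‖ < ‖s‖ + 1} := by
    refine Complex.differentiableOn_tsum_of_summable_norm
      ((summable_add_one_rpow_mul_add_two_rpow hα1 h).mul_left (C * (max 1 0 : ℕ) ^ (1 - α)))
      (fun m => (differentiableOn_zetaTail (by omega) hα _).const_mul _) hopen ?_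
    rintro m z ⟨hz, hzR⟩
    simpa only [Nat.zero_le, sup_of_le_left] using hC 0 m z hz hzR
  exact (hd.differentiableAt (hopen.mem_nhds ⟨hs, by linarith⟩)).differentiableWithinAt

lemma doubleZetaMul_eq_sub_one_mul_series {s : ℂ} (hs : 1 < s.re) :
    doubleZetaMul s₀ s = (s - 1) * doubleZetaSeries s₀ s := by
  have hs1 : s - 1 ≠ 0 := fun h => by simp [sub_eq_zero.1 h] at hs
  rw [doubleZetaMul, doubleZetaSeries, ← tsum_mul_left]
  refine tsum_congr fun m => ?_
  have h1 := (hasSum_zetaTail (k := m + 2) (by omega) hs).tsum_eq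
  have h2 : ∀ n : ℕ, 1 / (((m : ℂ) + 1) + ((n : ℂ) + 1)) ^ s = ((m + 2 + n : ℕ) : ℂ) ^ (-s) := by
    intro n
    rw [Complex.cpow_neg, one_div]
    congr 2
    push_cast
    ring
  simp only [h2, h1]
  field_simp

/-- Every admissible continuation agrees with `doubleZetaMul s₀ s / (s - 1)`: the factor `s - 1`
makes the comparison possible on a convex set, whichever way round the pole the domain of the
continuation lies. -/
lemma IsDoubleZetaContinuation.eq_doubleZetaMul_div (hα : 0 < α) (hα1 : α ≤ 1)
    (h : 2 < s₀.re + α) {U : Set ℂ} {F : ℂ → ℂ} (hF : IsDoubleZetaContinuation s₀ U F) {s : ℂ}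
    (hsU : s ∈ U) (hs : α < s.re) (hs1 : s ≠ 1) : F s = doubleZetaMul s₀ s / (s - 1) := by
  have hΩ : IsOpen {z : ℂ | α < z.re} := isOpen_lt continuous_const Complex.continuous_re
  have hΩc : Convex ℝ {z : ℂ | α < z.re} := convex_halfSpace_re_gt α
  have hVo : IsOpen (U ∩ {z : ℂ | α < z.re}) := hF.isOpen.inter hΩ
  have hVc := hF.convex.inter hΩc
  obtain ⟨p, hpU, hp1, hp2⟩ := hF.nonempty_inter
  have hpV : p ∈ U ∩ {z : ℂ | α < z.re} := ⟨hpU, hα1.trans_lt hp1⟩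
  have hHo : IsOpen (U ∩ doubleZetaHalfPlane s₀) := by
    refine hF.isOpen.inter ((isOpen_lt continuous_const Complex.continuous_re).inter ?_)
    exact isOpen_lt continuous_const
      (Complex.continuous_re.comp (continuous_const.add continuous_id))
  have hl : DifferentiableOn ℂ (fun z => (z - 1) * F z) (U ∩ {z : ℂ | α < z.re}) :=
    (differentiable_id.sub_const (1 : ℂ)).differentiableOn.mul
      (hF.differentiableOn.mono Set.inter_subset_left)
  have hr : DifferentiableOn ℂ (doubleZetaMul s₀) (U ∩ {z : ℂ | α < z.re}) :=
    (differentiableOn_doubleZetaMul hα hα1 h).mono Set.inter_subset_right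
  have hev : (fun z => (z - 1) * F z) =ᶠ[𝓝 p] doubleZetaMul s₀ := by
    filter_upwards [hHo.mem_nhds ⟨hpU, hp1, hp2⟩] with z hz
    rw [hF.eqOn hz, doubleZetaMul_eq_sub_one_mul_series hz.2.1]
  have := (hl.analyticOnNhd hVo).eqOn_of_preconnected_of_eventuallyEq (hr.analyticOnNhd hVo)
    hVc.isPreconnected hpV hev ⟨hsU, hs⟩
  rw [eq_div_iff (sub_ne_zero.2 hs1), ← this]
  ring

lemma isDoubleZetaContinuation_doubleZetaMul_div (hs₀ : 1 < s₀.re) (hα : 0 < α) (hα1 : α ≤ 1)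
    (h : 2 < s₀.re + α) :
    IsDoubleZetaContinuation s₀ ({s | α < s.re} ∩ {s | 0 < s.im})
      (fun s => doubleZetaMul s₀ s / (s - 1)) where
  isOpen := (isOpen_lt continuous_const Complex.continuous_re).inter
    (isOpen_lt continuous_const Complex.continuous_im)
  convex := (convex_halfSpace_re_gt α).inter (convex_halfSpace_im_gt 0)
  nonempty_inter := by
    refine ⟨2 + Complex.I, ⟨?_, ?_⟩, ?_, ?_⟩ <;> simp <;> linarith
  differentiableOn := by
    refine ((differentiableOn_doubleZetaMul hα hα1 h).mono Set.inter_subset_left).div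
      (differentiable_id.sub_const (1 : ℂ)).differentiableOn ?_
    rintro s ⟨-, hs⟩ h1
    have : s = 1 := sub_eq_zero.1 h1
    simp [this] at hs
  eqOn := by
    rintro s ⟨⟨-, hs⟩, hs1, -⟩
    have : s - 1 ≠ 0 := fun h => by simp [sub_eq_zero.1 h] at hs1
    simp only [doubleZetaMul_eq_sub_one_mul_series hs1]
    field_simp

lemma doubleZeta_eq_doubleZetaMul_div (hs₀ : 1 < s₀.re) (hα : 0 < α) (hα1 : α ≤ 1)
    (h : 2 < s₀.re + α) {s : ℂ} (hs : α < s.re) (hsi : 0 < s.im) :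
    doubleZeta s₀ s = doubleZetaMul s₀ s / (s - 1) := by
  have hs1 : s ≠ 1 := by rintro rfl; simp at hsi
  have hex : ∃ w : ℂ, ∃ (U : Set ℂ) (F : ℂ → ℂ),
      IsDoubleZetaContinuation s₀ U F ∧ s ∈ U ∧ F s = w :=
    ⟨_, _, _, isDoubleZetaContinuation_doubleZetaMul_div hs₀ hα hα1 h, ⟨hs, hsi⟩, rfl⟩
  rw [doubleZeta, dif_pos hex]
  obtain ⟨U, F, hF, hsU, hw⟩ := hex.choose_spec
  rw [← hw, hF.eq_doubleZetaMul_div hα hα1 h hsU hs hs1]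

end Continuation

/-! ### Approximation by Dirichlet polynomials -/

/-- The coefficient `∑_{1 ≤ m < k} m ^ (-s₀)` of `k ^ (-s)` in `ζ₂(s₀, s)`. -/
noncomputable def zetaCoeff (s₀ : ℂ) (k : ℕ) : ℂ := ∑ m ∈ Finset.Ico 1 k, 1 / (m : ℂ) ^ s₀

/-- The part of `(s - 1) * ζ₂(s₀, s)` that comes from the indices `k ≥ N`. -/
noncomputable def doubleZetaRem (s₀ : ℂ) (N : ℕ) (s : ℂ) : ℂ :=
  ∑' m : ℕ, 1 / ((m : ℂ) + 1) ^ s₀ * zetaTail (max (m + 2) N) s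

lemma doubleZetaRem_sub_succ {s₀ : ℂ} {α : ℝ} (hα : 0 < α) (hα1 : α ≤ 1) (h : 2 < s₀.re + α)
    {N : ℕ} (hN : 2 ≤ N) {s : ℂ} (hs : α < s.re) :
    doubleZetaRem s₀ N s - doubleZetaRem s₀ (N + 1) s
      = (s - 1) * (zetaCoeff s₀ N * (N : ℂ) ^ (-s)) := by
  have hN0 := summable_weight_mul_zetaTail hα hα1 h N hs
  have hN1 := summable_weight_mul_zetaTail hα hα1 h (N + 1) hs
  rw [doubleZetaRem, doubleZetaRem, ← hN0.tsum_sub hN1, tsum_eq_sum (s := Finset.range (N - 1))]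
  · rw [zetaCoeff, Finset.sum_Ico_eq_sum_range, Finset.sum_mul, Finset.mul_sum]
    refine Finset.sum_congr rfl fun m hm => ?_
    have hm' : m + 2 ≤ N := by have := Finset.mem_range.1 hm; omega
    rw [max_eq_right hm', max_eq_right (by omega : m + 2 ≤ N + 1),
      zetaTail_eq_add (by omega : 1 ≤ N) (hα.trans hs)]
    push_cast
    rw [add_comm (m : ℂ) 1]
    ring
  · intro m hm
    have hm' : N + 1 ≤ m + 2 := by have := mt Finset.mem_range.2 hm; omega
    rw [max_eq_left (by omega : N ≤ m + 2), max_eq_left hm', sub_self]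

lemma doubleZetaMul_eq_sum_add_rem {s₀ : ℂ} {α : ℝ} (hα : 0 < α) (hα1 : α ≤ 1)
    (h : 2 < s₀.re + α) {N : ℕ} (hN : 2 ≤ N) {s : ℂ} (hs : α < s.re) :
    doubleZetaMul s₀ s
      = (s - 1) * ∑ k ∈ Finset.Ico 2 N, zetaCoeff s₀ k * (k : ℂ) ^ (-s)
        + doubleZetaRem s₀ N s := by
  induction N, hN using Nat.le_induction with
  | base =>
    simp only [doubleZetaMul, doubleZetaRem, Finset.Ico_self, Finset.sum_empty, mul_zero, zero_add]
    refine tsum_congr fun m => ?_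
    rw [max_eq_left (by omega : 2 ≤ m + 2)]
  | succ N hN ih =>
    rw [ih, Finset.sum_Ico_succ_top hN, mul_add]
    linear_combination doubleZetaRem_sub_succ hα hα1 h hN hs

lemma exists_norm_doubleZetaRem_le {s₀ : ℂ} {σ : ℝ} (hσ : 0 < σ) (hσ1 : σ ≤ 1)
    (h : 2 < s₀.re + σ) : ∃ C : ℝ, 0 ≤ C ∧ ∀ (N : ℕ) (s : ℂ), 1 ≤ N → s.re = σ →
      ‖s‖ ≤ 3 / 2 * N → ‖doubleZetaRem s₀ N s‖ ≤ C * (N : ℝ) ^ (1 - σ) := by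
  obtain ⟨C, hC0, hC⟩ := exists_norm_zetaTail_le_rpow
  have hsum := summable_add_one_rpow_mul_add_two_rpow hσ1 h
  refine ⟨C * ∑' m : ℕ, ((m : ℝ) + 1) ^ (-s₀.re) * ((m : ℝ) + 2) ^ (1 - σ),
    mul_nonneg hC0 (tsum_nonneg fun m => by positivity), fun N s hN hs hsN => ?_⟩
  have hb : ∀ m : ℕ, ‖1 / ((m : ℂ) + 1) ^ s₀ * zetaTail (max (m + 2) N) s‖
      ≤ C * (N : ℝ) ^ (1 - σ) * (((m : ℝ) + 1) ^ (-s₀.re) * ((m : ℝ) + 2) ^ (1 - σ)) := by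
    intro m
    rw [norm_mul, norm_one_div_add_one_cpow]
    have h1 := hC (max (m + 2) N) s (by omega) (hs ▸ hσ) (hsN.trans (by gcongr; simp))
    rw [hs] at h1
    have h2 : ((max (m + 2) N : ℕ) : ℝ) ^ (1 - σ) ≤ (N : ℝ) ^ (1 - σ) * ((m : ℝ) + 2) ^ (1 - σ) := by
      rw [← Real.mul_rpow (by positivity) (by positivity)]
      refine Real.rpow_le_rpow (by positivity) ?_ (by linarith)
      have : max (m + 2) N ≤ N * (m + 2) :=
        max_le (Nat.le_mul_of_pos_left _ (by omega)) (Nat.le_mul_of_pos_right _ (by omega))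
      exact_mod_cast this
    calc _ ≤ ((m : ℝ) + 1) ^ (-s₀.re)
          * (C * ((N : ℝ) ^ (1 - σ) * ((m : ℝ) + 2) ^ (1 - σ))) := by
          refine mul_le_mul_of_nonneg_left (h1.trans ?_) (by positivity)
          gcongr
      _ = _ := by ring
  refine (tsum_of_norm_bounded (hsum.mul_left _).hasSum hb).trans (le_of_eq ?_)
  rw [tsum_mul_left]
  ring

/-! ### Mean squares of Dirichlet polynomials -/

/-- The Dirichlet polynomial `∑_{2 ≤ k < t} b k * k ^ (-i t)`, whose length grows with `t`. -/
noncomputable def dirichletPoly (b : ℕ → ℂ) (t : ℝ) : ℂ :=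
  ∑ k ∈ Finset.Ico 2 ⌈t⌉₊, b k * Complex.exp (-(Real.log k * Complex.I) * t)

lemma dirichletPoly_eq_sum_indicator (b : ℕ → ℂ) {t T : ℝ} (ht : t ≤ T) :
    dirichletPoly b t = ∑ k ∈ Finset.Ico 2 ⌈T⌉₊,
      (Set.Ioi (k : ℝ)).indicator
        (fun t : ℝ => b k * Complex.exp (-(Real.log k * Complex.I) * t)) t := by
  have hM : ⌈t⌉₊ ≤ ⌈T⌉₊ := Nat.ceil_mono ht
  rw [dirichletPoly]
  refine Finset.sum_subset_zero_on_sdiff (Finset.Ico_subset_Ico_right hM) (fun k hk => ?_)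
    (fun k hk => ?_)
  · simp only [Finset.mem_sdiff, Finset.mem_Ico, not_and, not_lt] at hk
    refine Set.indicator_of_notMem ?_ _
    simpa using hk.2 hk.1.1
  · exact (Set.indicator_of_mem (show t ∈ Set.Ioi (k : ℝ) from
      Nat.lt_ceil.1 (Finset.mem_Ico.1 hk).2) (f := fun t : ℝ =>
        b k * Complex.exp (-(Real.log k * Complex.I) * t))).symm

lemma normSq_dirichletPoly (b : ℕ → ℂ) {t T : ℝ} (ht : t ≤ T) :
    ((‖dirichletPoly b t‖ ^ 2 : ℝ) : ℂ)
      = ∑ k ∈ Finset.Ico 2 ⌈T⌉₊, ∑ l ∈ Finset.Ico 2 ⌈T⌉₊,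
        (Set.Ioi (max k l : ℝ)).indicator (fun t : ℝ => b k * (starRingEnd ℂ) (b l)
          * Complex.exp ((Real.log l - Real.log k : ℝ) * Complex.I * t)) t := by
  rw [Complex.ofReal_pow, ← Complex.mul_conj', dirichletPoly_eq_sum_indicator b ht, map_sum,
    Finset.sum_mul_sum]
  refine Finset.sum_congr rfl fun k _ => Finset.sum_congr rfl fun l _ => ?_
  by_cases hk : (k : ℝ) < t <;> by_cases hl : (l : ℝ) < t <;>
    simp only [Set.indicator, Set.mem_Ioi, hk, hl, max_lt_iff, and_self, and_true, and_false,
      if_true, if_false, map_zero, mul_zero, zero_mul]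
  rw [map_mul, ← Complex.exp_conj]
  simp only [map_mul, map_neg, Complex.conj_ofReal, Complex.conj_I]
  rw [mul_mul_mul_comm, ← Complex.exp_add]
  congr 2
  push_cast
  ring

lemma intervalIntegrable_indicator_Ioi (c a T : ℝ) {f : ℝ → ℂ} (hf : Continuous f) :
    IntervalIntegrable ((Set.Ioi c).indicator f) MeasureTheory.volume a T := by
  have := hf.intervalIntegrable (μ := MeasureTheory.volume) a T
  exact ⟨this.1.indicator measurableSet_Ioi, this.2.indicator measurableSet_Ioi⟩

lemma integral_indicator_Ioi {a c T : ℝ} (hac : a ≤ c) (hcT : c ≤ T) (f : ℝ → ℂ) :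
    ∫ t in a..T, (Set.Ioi c).indicator f t = ∫ t in c..T, f t := by
  rw [intervalIntegral.integral_of_le (hac.trans hcT), intervalIntegral.integral_of_le hcT,
    MeasureTheory.setIntegral_indicator measurableSet_Ioi, Set.Ioc_inter_Ioi,
    max_eq_right hac]

lemma intervalIntegrable_normSq_dirichletPoly (b : ℕ → ℂ) {T : ℝ} (hT : 2 ≤ T) :
    IntervalIntegrable (fun t => ‖dirichletPoly b t‖ ^ 2) MeasureTheory.volume 2 T := by
  have h : IntervalIntegrable (fun t => ((‖dirichletPoly b t‖ ^ 2 : ℝ) : ℂ))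
      MeasureTheory.volume 2 T := by
    refine (IntervalIntegrable.sum (Finset.Ico 2 ⌈T⌉₊) fun k _ =>
      IntervalIntegrable.sum (Finset.Ico 2 ⌈T⌉₊) fun l _ =>
        intervalIntegrable_indicator_Ioi (max k l : ℝ) 2 T (f := fun t : ℝ =>
          b k * (starRingEnd ℂ) (b l)
            * Complex.exp ((Real.log l - Real.log k : ℝ) * Complex.I * t)) (by fun_prop)).congr ?_
    intro t ht
    rw [Set.uIoc_of_le hT] at ht
    simp only [Finset.sum_apply]
    exact (normSq_dirichletPoly b ht.2).symm
  exact ⟨by simpa only [MeasureTheory.IntegrableOn, RCLike.re_eq_complex_re, Complex.ofReal_re] using h.1.re,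
    by simpa only [MeasureTheory.IntegrableOn, RCLike.re_eq_complex_re, Complex.ofReal_re] using h.2.re⟩

lemma integral_normSq_dirichletPoly (b : ℕ → ℂ) {T : ℝ} (hT : 2 ≤ T) :
    ((∫ t in (2 : ℝ)..T, ‖dirichletPoly b t‖ ^ 2 : ℝ) : ℂ)
      = ∑ k ∈ Finset.Ico 2 ⌈T⌉₊, ∑ l ∈ Finset.Ico 2 ⌈T⌉₊, b k * (starRingEnd ℂ) (b l)
        * ∫ t in (max k l : ℝ)..T,
            Complex.exp ((Real.log l - Real.log k : ℝ) * Complex.I * t) := by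
  rw [← intervalIntegral.integral_ofReal]
  have h1 : Set.EqOn (fun t => ((‖dirichletPoly b t‖ ^ 2 : ℝ) : ℂ)) (fun t =>
      ∑ k ∈ Finset.Ico 2 ⌈T⌉₊, ∑ l ∈ Finset.Ico 2 ⌈T⌉₊,
        (Set.Ioi (max k l : ℝ)).indicator (fun t : ℝ => b k * (starRingEnd ℂ) (b l)
          * Complex.exp ((Real.log l - Real.log k : ℝ) * Complex.I * t)) t) (Set.uIcc 2 T) := by
    intro t ht
    rw [Set.uIcc_of_le hT] at ht
    exact normSq_dirichletPoly b ht.2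
  have hi : ∀ k l : ℕ, IntervalIntegrable ((Set.Ioi (max k l : ℝ)).indicator (fun t : ℝ =>
      b k * (starRingEnd ℂ) (b l)
        * Complex.exp ((Real.log l - Real.log k : ℝ) * Complex.I * t)))
      MeasureTheory.volume 2 T := fun k l =>
    intervalIntegrable_indicator_Ioi _ _ _ (by fun_prop)
  rw [intervalIntegral.integral_congr h1, intervalIntegral.integral_finsetSum fun k _ => (
    IntervalIntegrable.sum (Finset.Ico 2 ⌈T⌉₊) fun l _ => hi k l).congr fun t _ =>
      Finset.sum_apply t _ _]
  refine Finset.sum_congr rfl fun k hk => ?_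
  rw [intervalIntegral.integral_finsetSum fun l _ => hi k l]
  refine Finset.sum_congr rfl fun l hl => ?_
  rw [Finset.mem_Ico, Nat.lt_ceil] at hk hl
  rw [integral_indicator_Ioi (le_max_of_le_left (by exact_mod_cast hk.1))
    (max_lt hk.2 hl.2).le, intervalIntegral.integral_const_mul]

lemma norm_integral_exp_mul_I_le {θ : ℝ} (hθ : θ ≠ 0) (a b : ℝ) :
    ‖∫ t in a..b, Complex.exp (θ * Complex.I * t)‖ ≤ 2 / |θ| := by
  have h0 : (θ : ℂ) * Complex.I ≠ 0 := mul_ne_zero (by exact_mod_cast hθ) Complex.I_ne_zero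
  have h1 : ∀ x : ℝ, ‖Complex.exp (θ * Complex.I * x)‖ = 1 := fun x => by
    rw [show (θ : ℂ) * Complex.I * x = ((θ * x : ℝ) : ℂ) * Complex.I by push_cast; ring]
    exact Complex.norm_exp_ofReal_mul_I _
  rw [integral_exp_mul_complex h0, norm_div]
  simp only [norm_mul, Complex.norm_I, mul_one, Complex.norm_real, Real.norm_eq_abs]
  gcongr
  refine (norm_sub_le _ _).trans ?_
  rw [h1, h1]; norm_num

lemma abs_integral_normSq_dirichletPoly_sub_le (b : ℕ → ℂ) {T : ℝ} (hT : 2 ≤ T) :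
    |(∫ t in (2 : ℝ)..T, ‖dirichletPoly b t‖ ^ 2)
        - ∑ k ∈ Finset.Ico 2 ⌈T⌉₊, ‖b k‖ ^ 2 * (T - k)|
      ≤ ∑ k ∈ Finset.Ico 2 ⌈T⌉₊, ∑ l ∈ Finset.Ico 2 ⌈T⌉₊,
        if k = l then 0 else ‖b k‖ * ‖b l‖ * (2 / |Real.log l - Real.log k|) := by
  rw [← Real.norm_eq_abs, ← Complex.norm_real, Complex.ofReal_sub,
    integral_normSq_dirichletPoly b hT, Complex.ofReal_sum, ← Finset.sum_sub_distrib]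
  refine norm_sum_le_of_le _ fun k hk => ?_
  have hd : ((‖b k‖ ^ 2 * (T - k) : ℝ) : ℂ) = ∑ l ∈ Finset.Ico 2 ⌈T⌉₊,
      if k = l then ((‖b k‖ ^ 2 * (T - k) : ℝ) : ℂ) else 0 := by
    rw [Finset.sum_ite_eq, if_pos hk]
  rw [hd, ← Finset.sum_sub_distrib]
  refine norm_sum_le_of_le _ fun l hl => ?_
  split_ifs with hkl
  · subst hkl
    refine le_of_eq (norm_eq_zero.2 ?_)
    rw [Complex.mul_conj']
    simp
  · rw [sub_zero, norm_mul, norm_mul, RCLike.norm_conj]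
    gcongr
    refine norm_integral_exp_mul_I_le (sub_ne_zero.2 fun h => hkl ?_) _ _
    rw [Finset.mem_Ico] at hk hl
    have hk0 : (0 : ℝ) < k := by exact_mod_cast (by omega : 0 < k)
    have hl0 : (0 : ℝ) < l := by exact_mod_cast (by omega : 0 < l)
    exact_mod_cast (Real.log_injOn_pos hl0 hk0 h).symm

/-- The partial fraction identity `1 / (k (l - k)) = (1 / k + 1 / (l - k)) / l` separates the
variables in the off-diagonal terms without splitting the range of `k`. -/
lemma rpow_mul_rpow_div_log_sub_le {k l : ℕ} (hk : 1 ≤ k) (hkl : k < l) {σ : ℝ} (hσ : σ ≤ 1) :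
    (k : ℝ) ^ (-σ) * (l : ℝ) ^ (-σ) / (Real.log l - Real.log k)
      ≤ (l : ℝ) ^ (1 - 2 * σ) * (1 / k + 1 / ((l : ℝ) - k)) := by
  have hk0 : (0 : ℝ) < k := by exact_mod_cast hk
  have hkl' : (k : ℝ) < l := by exact_mod_cast hkl
  have hl0 : (0 : ℝ) < l := hk0.trans hkl'
  have hd : (0 : ℝ) < l - k := by linarith
  have hlog : (l - k) / (l : ℝ) ≤ Real.log l - Real.log k := by
    have h1 := Real.one_sub_inv_le_log_of_pos (div_pos hl0 hk0)
    rw [Real.log_div hl0.ne' hk0.ne', inv_div] at h1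
    calc (l - k) / (l : ℝ) = 1 - k / l := by field_simp
      _ ≤ _ := h1
  have h2 : (k : ℝ) ^ (-σ) ≤ (l : ℝ) ^ (1 - σ) / k := by
    rw [le_div_iff₀ hk0]
    calc (k : ℝ) ^ (-σ) * k = (k : ℝ) ^ (1 - σ) := by
          rw [sub_eq_add_neg, add_comm, Real.rpow_add hk0, Real.rpow_one]
      _ ≤ _ := Real.rpow_le_rpow hk0.le hkl'.le (by linarith)
  have h3 : (l : ℝ) ^ (1 - 2 * σ) = (l : ℝ) ^ (1 - σ) * (l : ℝ) ^ (-σ) := by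
    rw [← Real.rpow_add hl0]; congr 1; ring
  calc _ ≤ (l : ℝ) ^ (1 - σ) / k * (l : ℝ) ^ (-σ) / ((l - k) / (l : ℝ)) := by gcongr
    _ = (l : ℝ) ^ (1 - 2 * σ) * (1 / k + 1 / ((l : ℝ) - k)) := by
      rw [h3]
      field_simp
      ring

lemma sum_Ico_one_div_add_le (l : ℕ) :
    ∑ k ∈ Finset.Ico 2 l, (1 / (k : ℝ) + 1 / ((l : ℝ) - k))
      ≤ 2 * ∑ k ∈ Finset.Ico 1 l, 1 / (k : ℝ) := by
  have h0 : ∀ k ∈ Finset.Ico 1 l, 0 ≤ 1 / (k : ℝ) + 1 / ((l : ℝ) - k) := by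
    intro k hk
    have : (k : ℝ) < l := by exact_mod_cast (Finset.mem_Ico.1 hk).2
    have : (0 : ℝ) < l - k := by linarith
    positivity
  have h1 : ∑ k ∈ Finset.Ico 1 l, 1 / ((l : ℝ) - k) = ∑ k ∈ Finset.Ico 1 l, 1 / (k : ℝ) := by
    have := Finset.sum_Ico_reflect (fun k : ℕ => 1 / (k : ℝ)) 1 (Nat.le_succ l)
    rw [Nat.add_sub_cancel_left, Nat.add_sub_cancel] at this
    rw [← this]
    refine Finset.sum_congr rfl fun k hk => ?_
    rw [Nat.cast_sub (Finset.mem_Ico.1 hk).2.le]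
  calc _ ≤ ∑ k ∈ Finset.Ico 1 l, (1 / (k : ℝ) + 1 / ((l : ℝ) - k)) :=
        Finset.sum_le_sum_of_subset_of_nonneg (Finset.Ico_subset_Ico_left (by norm_num))
          fun k hk _ => h0 k hk
    _ = _ := by rw [Finset.sum_add_distrib, h1]; ring

lemma sum_offDiag_le {b : ℕ → ℂ} {A σ : ℝ} (hσ : σ ≤ 1)
    (hb : ∀ k, 1 ≤ k → ‖b k‖ ≤ A * (k : ℝ) ^ (-σ)) (M : ℕ) :
    (∑ k ∈ Finset.Ico 2 M, ∑ l ∈ Finset.Ico 2 M,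
        if k = l then 0 else ‖b k‖ * ‖b l‖ * (2 / |Real.log l - Real.log k|))
      ≤ 8 * A ^ 2 * (∑ k ∈ Finset.Ico 1 M, 1 / (k : ℝ))
        * ∑ l ∈ Finset.Ico 2 M, (l : ℝ) ^ (1 - 2 * σ) := by
  set H := ∑ k ∈ Finset.Ico 1 M, 1 / (k : ℝ)
  have hA : 0 ≤ A := by simpa using (norm_nonneg _).trans (hb 1 le_rfl)
  set G : ℕ → ℕ → ℝ := fun k l =>
    if k < l then 2 * A ^ 2 * ((l : ℝ) ^ (1 - 2 * σ) * (1 / k + 1 / ((l : ℝ) - k))) else 0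
    with hG
  have hlt : ∀ k l : ℕ, 1 ≤ k → k < l →
      ‖b k‖ * ‖b l‖ * (2 / |Real.log l - Real.log k|) ≤ G k l := by
    intro k l hk hkl
    have hk0 : (0 : ℝ) < k := by exact_mod_cast hk
    have hlog : 0 < Real.log l - Real.log k :=
      sub_pos.2 (Real.log_lt_log hk0 (by exact_mod_cast hkl))
    rw [abs_of_pos hlog]
    simp only [hG, if_pos hkl]
    calc _ ≤ (A * (k : ℝ) ^ (-σ)) * (A * (l : ℝ) ^ (-σ)) * (2 / (Real.log l - Real.log k)) := by
          gcongr
          · exact hb k hk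
          · exact hb l (by omega)
      _ = 2 * A ^ 2 * ((k : ℝ) ^ (-σ) * (l : ℝ) ^ (-σ) / (Real.log l - Real.log k)) := by ring
      _ ≤ _ := by
          gcongr
          exact rpow_mul_rpow_div_log_sub_le hk hkl hσ
  have hpt : ∀ k ∈ Finset.Ico 2 M, ∀ l ∈ Finset.Ico 2 M,
      (if k = l then 0 else ‖b k‖ * ‖b l‖ * (2 / |Real.log l - Real.log k|))
        ≤ G k l + G l k := by
    intro k hk l hl
    rw [Finset.mem_Ico] at hk hl
    rcases lt_trichotomy k l with h | h | h
    · rw [if_neg h.ne]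
      have : G l k = 0 := by simp only [hG, if_neg h.not_gt]
      rw [this, add_zero]
      exact hlt k l (by omega) h
    · simp [h, hG]
    · rw [if_neg h.ne']
      have : G k l = 0 := by simp only [hG, if_neg h.not_gt]
      rw [this, zero_add, mul_comm ‖b k‖, abs_sub_comm]
      exact hlt l k (by omega) h
  have hcol : ∀ l ∈ Finset.Ico 2 M,
      ∑ k ∈ Finset.Ico 2 M, G k l ≤ 4 * A ^ 2 * H * (l : ℝ) ^ (1 - 2 * σ) := by
    intro l hl
    rw [Finset.mem_Ico] at hl
    have hf : (Finset.Ico 2 M).filter (fun k => k < l) = Finset.Ico 2 l := by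
      ext k; simp only [Finset.mem_filter, Finset.mem_Ico]; omega
    simp only [hG]
    rw [← Finset.sum_filter, hf, ← Finset.mul_sum, ← Finset.mul_sum]
    have h1 := sum_Ico_one_div_add_le l
    have h2 : ∑ k ∈ Finset.Ico 1 l, 1 / (k : ℝ) ≤ H :=
      Finset.sum_le_sum_of_subset_of_nonneg (Finset.Ico_subset_Ico_right hl.2.le)
        fun k _ _ => by positivity
    calc _ ≤ 2 * A ^ 2 * ((l : ℝ) ^ (1 - 2 * σ) * (2 * H)) := by
          gcongr
          linarith
      _ = _ := by ring
  calc _ ≤ ∑ k ∈ Finset.Ico 2 M, ∑ l ∈ Finset.Ico 2 M, (G k l + G l k) :=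
        Finset.sum_le_sum fun k hk => Finset.sum_le_sum fun l hl => hpt k hk l hl
    _ = 2 * ∑ l ∈ Finset.Ico 2 M, ∑ k ∈ Finset.Ico 2 M, G k l := by
        simp only [Finset.sum_add_distrib]
        rw [Finset.sum_comm (f := fun k l => G k l)]
        ring
    _ ≤ 2 * ∑ l ∈ Finset.Ico 2 M, 4 * A ^ 2 * H * (l : ℝ) ^ (1 - 2 * σ) := by
        gcongr with l hl
        exact hcol l hl
    _ = _ := by rw [← Finset.mul_sum]; ring

lemma sum_rpow_le_integral {a b : ℕ} (ha : 1 ≤ a) (hab : a ≤ b) {c : ℝ} (hc : 0 ≤ c)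
    (hc1 : c ≠ 1) :
    ∑ k ∈ Finset.Ico (a + 1) (b + 1), (k : ℝ) ^ (-c)
      ≤ ((b : ℝ) ^ (1 - c) - (a : ℝ) ^ (1 - c)) / (1 - c) := by
  have ha0 : (0 : ℝ) < a := by exact_mod_cast ha
  have hab' : (a : ℝ) ≤ b := by exact_mod_cast hab
  have hanti : AntitoneOn (fun x : ℝ => x ^ (-c)) (Set.Icc a b) := fun x hx y _ hxy =>
    Real.rpow_le_rpow_of_nonpos (ha0.trans_le hx.1) hxy (by linarith)
  have h1 := hanti.sum_le_integral_Ico hab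
  rw [integral_rpow (Or.inr ⟨fun h => hc1 (by linarith), by
    rw [Set.uIcc_of_le hab']; exact fun h => ha0.not_ge h.1⟩)] at h1
  rw [← Finset.sum_Ico_add' (fun k : ℕ => (k : ℝ) ^ (-c)) a b 1]
  rw [show -c + 1 = 1 - c by ring] at h1
  exact h1

lemma tsum_rpow_tail_le {a : ℕ} (ha : 1 ≤ a) {c : ℝ} (hc : 1 < c) :
    ∑' j : ℕ, ((j + (a + 1) : ℕ) : ℝ) ^ (-c) ≤ (a : ℝ) ^ (1 - c) / (c - 1) := by
  refine Real.tsum_le_of_sum_range_le (fun j => by positivity) fun n => ?_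
  have h1 := sum_rpow_le_integral ha (Nat.le_add_right a n) (by linarith : 0 ≤ c) hc.ne'
  rw [Finset.sum_Ico_eq_sum_range, show a + n + 1 - (a + 1) = n by omega] at h1
  have h2 : 0 ≤ ((a + n : ℕ) : ℝ) ^ (1 - c) := by positivity
  calc _ = ∑ j ∈ Finset.range n, ((a + 1 + j : ℕ) : ℝ) ^ (-c) := by
        simp only [add_comm _ (a + 1)]
    _ ≤ _ := h1
    _ = ((a : ℝ) ^ (1 - c) - ((a + n : ℕ) : ℝ) ^ (1 - c)) / (c - 1) := by
        rw [← neg_sub c 1, div_neg, ← neg_div, neg_sub]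
    _ ≤ _ := by
        have : 0 < c - 1 := by linarith
        gcongr
        linarith

lemma sum_Ico_one_div_le {T : ℝ} (hT : 2 ≤ T) :
    ∑ k ∈ Finset.Ico 1 ⌈T⌉₊, 1 / (k : ℝ) ≤ 3 * Real.log T := by
  have hM : 2 ≤ ⌈T⌉₊ := by exact_mod_cast hT.trans (Nat.le_ceil T)
  have hlt : ((⌈T⌉₊ - 1 : ℕ) : ℝ) < T := Nat.lt_ceil.1 (by omega)
  have h1 := harmonic_le_one_add_log (⌈T⌉₊ - 1)
  have h2 : ((harmonic (⌈T⌉₊ - 1) : ℚ) : ℝ) = ∑ k ∈ Finset.Ico 1 ⌈T⌉₊, 1 / (k : ℝ) := by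
    rw [harmonic, Finset.sum_Ico_eq_sum_range]
    push_cast
    refine Finset.sum_congr rfl fun k _ => ?_
    rw [one_div, add_comm]
  have h3 : Real.log ((⌈T⌉₊ - 1 : ℕ) : ℝ) ≤ Real.log T :=
    Real.log_le_log (by exact_mod_cast (by omega : 0 < ⌈T⌉₊ - 1)) hlt.le
  have h4 : Real.log 2 ≤ Real.log T := Real.log_le_log (by norm_num) hT
  linarith [Real.log_two_gt_d9]

lemma exists_harmonic_mul_sum_rpow_le {σ : ℝ} (hσ : 1 / 2 < σ) (hσ1 : σ ≤ 1) :
    ∃ C : ℝ, 0 ≤ C ∧ ∀ T : ℝ, 2 ≤ T →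
      (∑ k ∈ Finset.Ico 1 ⌈T⌉₊, 1 / (k : ℝ)) * ∑ l ∈ Finset.Ico 2 ⌈T⌉₊, (l : ℝ) ^ (1 - 2 * σ)
        ≤ C * (T ^ (2 - 2 * σ) * Real.log T + T ^ (1 / 2 : ℝ)) := by
  rcases hσ1.lt_or_eq with hlt | rfl
  · refine ⟨3 / (2 - 2 * σ), div_nonneg (by norm_num) (by linarith), fun T hT => ?_⟩
    have hd : 0 < 2 - 2 * σ := by linarith
    have hlog : 0 ≤ Real.log T := Real.log_nonneg (by linarith)
    have hM : 2 ≤ ⌈T⌉₊ := by exact_mod_cast hT.trans (Nat.le_ceil T)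
    have hle : ((⌈T⌉₊ - 1 : ℕ) : ℝ) ≤ T := (Nat.lt_ceil.1 (by omega)).le
    have h1 := sum_rpow_le_integral le_rfl (by omega : 1 ≤ ⌈T⌉₊ - 1)
      (by linarith : 0 ≤ 2 * σ - 1) (by linarith)
    rw [show ⌈T⌉₊ - 1 + 1 = ⌈T⌉₊ by omega, show -(2 * σ - 1) = 1 - 2 * σ by ring,
      show 1 - (2 * σ - 1) = 2 - 2 * σ by ring] at h1
    have h2 : ∑ l ∈ Finset.Ico 2 ⌈T⌉₊, (l : ℝ) ^ (1 - 2 * σ) ≤ T ^ (2 - 2 * σ) / (2 - 2 * σ) := by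
      refine h1.trans ?_
      gcongr
      have : ((⌈T⌉₊ - 1 : ℕ) : ℝ) ^ (2 - 2 * σ) ≤ T ^ (2 - 2 * σ) :=
        Real.rpow_le_rpow (by positivity) hle hd.le
      simp only [Nat.cast_one, Real.one_rpow]
      linarith
    calc _ ≤ (3 * Real.log T) * (T ^ (2 - 2 * σ) / (2 - 2 * σ)) :=
          mul_le_mul (sum_Ico_one_div_le hT) h2
            (Finset.sum_nonneg fun l _ => by positivity) (by positivity)
      _ = 3 / (2 - 2 * σ) * (T ^ (2 - 2 * σ) * Real.log T) := by ring
      _ ≤ _ := by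
          have : 0 ≤ T ^ (1 / 2 : ℝ) := by positivity
          gcongr
          linarith
  · -- At `σ = 1` both factors are logarithmic, and the term `T ^ (1 / 2)` absorbs the product.
    refine ⟨144, by norm_num, fun T hT => ?_⟩
    have hT0 : (0 : ℝ) < T := by linarith
    have hlog : 0 ≤ Real.log T := Real.log_nonneg (by linarith)
    have h1 := sum_Ico_one_div_le hT
    have h2 : ∑ l ∈ Finset.Ico 2 ⌈T⌉₊, (l : ℝ) ^ (1 - 2 * 1 : ℝ)
        ≤ ∑ k ∈ Finset.Ico 1 ⌈T⌉₊, 1 / (k : ℝ) := by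
      have e : ∀ l : ℕ, (l : ℝ) ^ (1 - 2 * 1 : ℝ) = 1 / l := fun l => by
        rw [show (1 - 2 * 1 : ℝ) = -1 by norm_num, Real.rpow_neg_one, one_div]
      simp only [e]
      exact Finset.sum_le_sum_of_subset_of_nonneg (Finset.Ico_subset_Ico_left (by norm_num))
        fun k _ _ => by positivity
    have h3 : Real.log T ≤ 4 * T ^ (1 / 4 : ℝ) := by
      have := Real.log_le_rpow_div hT0.le (by norm_num : (0 : ℝ) < 1 / 4)
      linarith
    have h4 : T ^ (1 / 4 : ℝ) * T ^ (1 / 4 : ℝ) = T ^ (1 / 2 : ℝ) := by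
      rw [← Real.rpow_add hT0]; norm_num
    calc _ ≤ (3 * (4 * T ^ (1 / 4 : ℝ))) * (3 * (4 * T ^ (1 / 4 : ℝ))) :=
          mul_le_mul (by linarith) (by linarith) (Finset.sum_nonneg fun l _ => by positivity)
            (by positivity)
      _ = 144 * T ^ (1 / 2 : ℝ) := by rw [← h4]; ring
      _ ≤ _ := by
          have : 0 ≤ T ^ (2 - 2 * 1 : ℝ) * Real.log T := by positivity
          exact mul_le_mul_of_nonneg_left (le_add_of_nonneg_left this) (by norm_num)

section MeanSquare

variable {b : ℕ → ℂ} {A σ : ℝ}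

lemma normSq_coeff_le (hb : ∀ k, 1 ≤ k → ‖b k‖ ≤ A * (k : ℝ) ^ (-σ)) {k : ℕ} (hk : 1 ≤ k) :
    ‖b k‖ ^ 2 ≤ A ^ 2 * (k : ℝ) ^ (-(2 * σ)) := by
  have hk0 : (0 : ℝ) < k := by exact_mod_cast hk
  calc ‖b k‖ ^ 2 ≤ (A * (k : ℝ) ^ (-σ)) ^ 2 := by
        gcongr
        exact hb k hk
    _ = _ := by
        rw [mul_pow, ← Real.rpow_natCast ((k : ℝ) ^ (-σ)), ← Real.rpow_mul hk0.le]
        congr 2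
        push_cast
        ring

lemma summable_normSq_coeff (hσ : 1 / 2 < σ)
    (hb : ∀ k, 1 ≤ k → ‖b k‖ ≤ A * (k : ℝ) ^ (-σ)) : Summable fun k : ℕ => ‖b (k + 2)‖ ^ 2 := by
  have h : Summable fun k : ℕ => (k : ℝ) ^ (-(2 * σ)) := Real.summable_nat_rpow.2 (by linarith)
  exact Summable.of_nonneg_of_le (fun k => by positivity)
    (fun k => normSq_coeff_le hb (by omega)) (((summable_nat_add_iff 2).2 h).mul_left (A ^ 2))

lemma abs_sum_diag_sub_le (hσ : 1 / 2 < σ) (hb : ∀ k, 1 ≤ k → ‖b k‖ ≤ A * (k : ℝ) ^ (-σ))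
    {T : ℝ} (hT : 2 ≤ T) :
    |∑ k ∈ Finset.Ico 2 ⌈T⌉₊, ‖b k‖ ^ 2 * (T - k) - (∑' k : ℕ, ‖b (k + 2)‖ ^ 2) * T|
      ≤ A ^ 2 * ∑ l ∈ Finset.Ico 2 ⌈T⌉₊, (l : ℝ) ^ (1 - 2 * σ)
        + A ^ 2 * (2 ^ (2 * σ - 1) / (2 * σ - 1)) * T ^ (2 - 2 * σ) := by
  have hT0 : (0 : ℝ) < T := by linarith
  have hM : 2 ≤ ⌈T⌉₊ := by exact_mod_cast hT.trans (Nat.le_ceil T)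
  obtain ⟨a, ha⟩ : ∃ a, ⌈T⌉₊ = a + 1 := ⟨⌈T⌉₊ - 1, by omega⟩
  have ha1 : 1 ≤ a := by omega
  have hTa : T / 2 ≤ a := by
    have h1 : T ≤ (a : ℝ) + 1 := by
      have := Nat.le_ceil T
      rw [ha] at this
      exact_mod_cast this
    linarith
  have hsplit : ∑' k : ℕ, ‖b (k + 2)‖ ^ 2
      = ∑ k ∈ Finset.Ico 2 ⌈T⌉₊, ‖b k‖ ^ 2 + ∑' j : ℕ, ‖b (j + ⌈T⌉₊)‖ ^ 2 := by
    rw [← (summable_normSq_coeff hσ hb).sum_add_tsum_nat_add (⌈T⌉₊ - 2),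
      Finset.sum_Ico_eq_sum_range]
    simp only [add_comm 2]
    congr 2
    funext j
    rw [show j + (⌈T⌉₊ - 2) + 2 = j + ⌈T⌉₊ by omega]
  have hdiff : (∑' k : ℕ, ‖b (k + 2)‖ ^ 2) * T - ∑ k ∈ Finset.Ico 2 ⌈T⌉₊, ‖b k‖ ^ 2 * (T - k)
      = ∑ k ∈ Finset.Ico 2 ⌈T⌉₊, ‖b k‖ ^ 2 * k + (∑' j : ℕ, ‖b (j + ⌈T⌉₊)‖ ^ 2) * T := by
    simp only [hsplit, mul_sub, Finset.sum_sub_distrib, ← Finset.sum_mul]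
    ring
  have h1 : ∑ k ∈ Finset.Ico 2 ⌈T⌉₊, ‖b k‖ ^ 2 * k
      ≤ A ^ 2 * ∑ l ∈ Finset.Ico 2 ⌈T⌉₊, (l : ℝ) ^ (1 - 2 * σ) := by
    rw [Finset.mul_sum]
    refine Finset.sum_le_sum fun k hk => ?_
    have hk1 : 1 ≤ k := by have := (Finset.mem_Ico.1 hk).1; omega
    have hk0 : (0 : ℝ) < k := by exact_mod_cast hk1
    calc ‖b k‖ ^ 2 * k ≤ A ^ 2 * (k : ℝ) ^ (-(2 * σ)) * k := by
          gcongr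
          exact normSq_coeff_le hb hk1
      _ = _ := by rw [sub_eq_neg_add 1, Real.rpow_add hk0, Real.rpow_one, mul_assoc]
  have h2 : ∑' j : ℕ, ‖b (j + ⌈T⌉₊)‖ ^ 2
      ≤ A ^ 2 * (2 ^ (2 * σ - 1) / (2 * σ - 1) * T ^ (1 - 2 * σ)) := by
    have hs : Summable fun k : ℕ => (k : ℝ) ^ (-(2 * σ)) :=
      Real.summable_nat_rpow.2 (by linarith)
    have hs' := ((summable_nat_add_iff (a + 1)).2 hs).mul_left (A ^ 2)
    have hle : ∀ j : ℕ, ‖b (j + ⌈T⌉₊)‖ ^ 2 ≤ A ^ 2 * ((j + (a + 1) : ℕ) : ℝ) ^ (-(2 * σ)) := by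
      intro j
      rw [ha]
      exact normSq_coeff_le hb (by omega)
    refine ((Summable.of_nonneg_of_le (fun j => by positivity) hle hs').tsum_le_tsum hle hs').trans
      ?_
    rw [tsum_mul_left]
    gcongr
    refine (tsum_rpow_tail_le ha1 (by linarith : 1 < 2 * σ)).trans ?_
    have hd : 0 < 2 * σ - 1 := by linarith
    have : (a : ℝ) ^ (1 - 2 * σ) ≤ 2 ^ (2 * σ - 1) * T ^ (1 - 2 * σ) := by
      refine (Real.rpow_le_rpow_of_nonpos (by linarith) hTa (by linarith)).trans (le_of_eq ?_)
      rw [Real.div_rpow hT0.le (by norm_num), ← neg_sub (2 * σ) 1,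
        Real.rpow_neg (by norm_num : (0 : ℝ) ≤ 2), div_inv_eq_mul, mul_comm]
    calc _ ≤ 2 ^ (2 * σ - 1) * T ^ (1 - 2 * σ) / (2 * σ - 1) := by gcongr
      _ = _ := by ring
  have h0 : 0 ≤ (∑' k : ℕ, ‖b (k + 2)‖ ^ 2) * T
      - ∑ k ∈ Finset.Ico 2 ⌈T⌉₊, ‖b k‖ ^ 2 * (T - k) := by
    rw [hdiff]
    exact add_nonneg (Finset.sum_nonneg fun k _ => by positivity)
      (mul_nonneg (tsum_nonneg fun j => by positivity) hT0.le)
  rw [abs_sub_comm, abs_of_nonneg h0, hdiff]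
  refine add_le_add h1 ?_
  calc _ ≤ A ^ 2 * (2 ^ (2 * σ - 1) / (2 * σ - 1) * T ^ (1 - 2 * σ)) * T := by gcongr
    _ = _ := by
      rw [show 2 - 2 * σ = 1 - 2 * σ + 1 by ring, Real.rpow_add hT0, Real.rpow_one]
      ring

lemma exists_abs_integral_normSq_sub_le (hσ : 1 / 2 < σ) (hσ1 : σ ≤ 1)
    (hb : ∀ k, 1 ≤ k → ‖b k‖ ≤ A * (k : ℝ) ^ (-σ)) :
    ∃ C : ℝ, 0 ≤ C ∧ ∀ T : ℝ, 2 ≤ T →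
      |(∫ t in (2 : ℝ)..T, ‖dirichletPoly b t‖ ^ 2) - (∑' k : ℕ, ‖b (k + 2)‖ ^ 2) * T|
        ≤ C * (T ^ (2 - 2 * σ) * Real.log T + T ^ (1 / 2 : ℝ)) := by
  obtain ⟨C, hC0, hC⟩ := exists_harmonic_mul_sum_rpow_le hσ hσ1
  set B := 2 ^ (2 * σ - 1) / (2 * σ - 1) with hB
  have hB0 : 0 ≤ B := div_nonneg (by positivity) (by linarith)
  refine ⟨9 * A ^ 2 * C + 2 * A ^ 2 * B, by positivity, fun T hT => ?_⟩
  have hT0 : (0 : ℝ) < T := by linarith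
  set H := ∑ k ∈ Finset.Ico 1 ⌈T⌉₊, 1 / (k : ℝ) with hH
  set P := ∑ l ∈ Finset.Ico 2 ⌈T⌉₊, (l : ℝ) ^ (1 - 2 * σ) with hP
  have hP0 : 0 ≤ P := Finset.sum_nonneg fun l _ => by positivity
  have hM : 2 ≤ ⌈T⌉₊ := by exact_mod_cast hT.trans (Nat.le_ceil T)
  have hH1 : 1 ≤ H := by
    have : (1 : ℕ) ∈ Finset.Ico 1 ⌈T⌉₊ := Finset.mem_Ico.2 ⟨le_rfl, by omega⟩
    simpa [hH] using Finset.single_le_sum (f := fun k : ℕ => 1 / (k : ℝ))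
      (fun k _ => by positivity) this
  have hlog : 1 / 2 ≤ Real.log T := by
    have := Real.log_le_log (by norm_num) hT
    linarith [Real.log_two_gt_d9]
  have h1 := (abs_integral_normSq_dirichletPoly_sub_le b hT).trans (sum_offDiag_le hσ1 hb _)
  have h2 := abs_sum_diag_sub_le hσ hb hT
  rw [← hH, ← hP] at h1
  rw [← hP, ← hB] at h2
  have h3 := hC T hT
  rw [← hH, ← hP] at h3
  have h4 : P ≤ H * P := le_mul_of_one_le_left hP0 hH1
  have hX : 0 ≤ T ^ (2 - 2 * σ) := by positivity
  have h5 : T ^ (2 - 2 * σ) ≤ 2 * (T ^ (2 - 2 * σ) * Real.log T + T ^ (1 / 2 : ℝ)) := by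
    have : 0 ≤ T ^ (1 / 2 : ℝ) := by positivity
    nlinarith
  have hA : 0 ≤ A ^ 2 := sq_nonneg A
  calc _ ≤ 8 * A ^ 2 * H * P + (A ^ 2 * P + A ^ 2 * B * T ^ (2 - 2 * σ)) :=
        (abs_sub_le _ _ _).trans (add_le_add h1 h2)
    _ ≤ 8 * A ^ 2 * (H * P) + (A ^ 2 * (H * P) + A ^ 2 * B * T ^ (2 - 2 * σ)) := by
        rw [mul_assoc _ H P]
        gcongr
    _ = 9 * A ^ 2 * (H * P) + A ^ 2 * B * T ^ (2 - 2 * σ) := by ring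
    _ ≤ 9 * A ^ 2 * (C * (T ^ (2 - 2 * σ) * Real.log T + T ^ (1 / 2 : ℝ)))
        + A ^ 2 * B * (2 * (T ^ (2 - 2 * σ) * Real.log T + T ^ (1 / 2 : ℝ))) := by gcongr
    _ = _ := by ring

end MeanSquare

/-! ### The mean square of the double zeta function -/

lemma exists_norm_zetaCoeff_le {s₀ : ℂ} (hs₀ : 1 < s₀.re) :
    ∃ A : ℝ, ∀ k, ‖zetaCoeff s₀ k‖ ≤ A := by
  have hs : Summable fun m : ℕ => (m : ℝ) ^ (-s₀.re) := Real.summable_nat_rpow.2 (by linarith)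
  refine ⟨∑' m : ℕ, (m : ℝ) ^ (-s₀.re), fun k => ?_⟩
  refine (norm_sum_le_of_le _ fun m hm => ?_).trans
    (hs.sum_le_tsum (Finset.Ico 1 k) fun m _ => by positivity)
  rw [norm_div, norm_one, Complex.norm_natCast_cpow_of_pos (Finset.mem_Ico.1 hm).1,
    Real.rpow_neg (by positivity), one_div]

/-- The coefficients of `ζ₂(s₀, σ + i t)`, as a Dirichlet series in `k ^ (-i t)`. -/
noncomputable def lineCoeff (s₀ : ℂ) (σ : ℝ) (k : ℕ) : ℂ := zetaCoeff s₀ k * (k : ℂ) ^ (-(σ : ℂ))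

lemma norm_lineCoeff (s₀ : ℂ) (σ : ℝ) {k : ℕ} (hk : 1 ≤ k) :
    ‖lineCoeff s₀ σ k‖ = ‖zetaCoeff s₀ k‖ * (k : ℝ) ^ (-σ) := by
  rw [lineCoeff, norm_mul, Complex.norm_natCast_cpow_of_pos hk]
  simp

lemma doubleZetaSqTerm_eq_normSq (s₀ : ℂ) (σ : ℝ) {k : ℕ} (hk : 1 ≤ k) :
    doubleZetaSqTerm s₀ (2 * σ) k = ‖lineCoeff s₀ σ k‖ ^ 2 := by
  have hk0 : (0 : ℝ) < k := by exact_mod_cast hk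
  rw [norm_lineCoeff s₀ σ hk, mul_pow, doubleZetaSqTerm, zetaCoeff, one_div,
    ← Real.rpow_neg hk0.le, ← Real.rpow_natCast ((k : ℝ) ^ (-σ)), ← Real.rpow_mul hk0.le]
  congr 2
  push_cast
  ring

lemma lineCoeff_mul_exp (s₀ : ℂ) (σ t : ℝ) {k : ℕ} (hk : 1 ≤ k) :
    lineCoeff s₀ σ k * Complex.exp (-(Real.log k * Complex.I) * t)
      = zetaCoeff s₀ k * (k : ℂ) ^ (-((σ : ℂ) + t * Complex.I)) := by
  have hk0 : (k : ℂ) ≠ 0 := by exact_mod_cast (by omega : k ≠ 0)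
  rw [neg_add, Complex.cpow_add _ _ hk0, lineCoeff, mul_assoc,
    Complex.cpow_def_of_ne_zero hk0 (-(t * Complex.I)), ← Complex.natCast_log]
  congr 3
  ring

lemma norm_ofReal_add_mul_I_le {σ t : ℝ} (hσ : 0 ≤ σ) (hσ1 : σ ≤ 1) (ht : 2 ≤ t) :
    ‖(σ : ℂ) + t * Complex.I‖ ≤ 3 / 2 * t := by
  refine (norm_add_le _ _).trans ?_
  rw [norm_mul, Complex.norm_I, mul_one, Complex.norm_real, Complex.norm_real,
    Real.norm_of_nonneg hσ, Real.norm_of_nonneg (by linarith)]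
  linarith

section CriticalStrip

variable {s₀ : ℂ} {σ : ℝ}

/-- The choice of length `⌈t⌉` balances the tail against `1 / |s - 1|` and makes the error square
integrable over `[2, ∞)`. -/
lemma exists_norm_doubleZeta_sub_dirichletPoly_le (hs₀ : 1 < s₀.re) (hσ : 0 < σ) (hσ1 : σ ≤ 1)
    (h : 2 < s₀.re + σ) : ∃ C : ℝ, 0 ≤ C ∧ ∀ t : ℝ, 2 ≤ t →
      ‖doubleZeta s₀ ((σ : ℂ) + t * Complex.I) - dirichletPoly (lineCoeff s₀ σ) t‖
        ≤ C * t ^ (-σ) := by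
  obtain ⟨C, hC0, hC⟩ := exists_norm_doubleZetaRem_le hσ hσ1 h
  obtain ⟨α, hα, hασ⟩ : ∃ α, max 0 (2 - s₀.re) < α ∧ α < σ :=
    exists_between (max_lt hσ (by linarith))
  obtain ⟨hα0, hα2⟩ := max_lt_iff.1 hα
  refine ⟨2 * C, by positivity, fun t ht => ?_⟩
  have ht0 : 0 < t := by linarith
  set s : ℂ := (σ : ℂ) + t * Complex.I with hs
  have hre : s.re = σ := by simp [hs]
  have him : s.im = t := by simp [hs]
  have hN : 2 ≤ ⌈t⌉₊ := by exact_mod_cast ht.trans (Nat.le_ceil t)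
  have hNt : (⌈t⌉₊ : ℝ) ≤ 2 * t := by linarith [Nat.ceil_lt_add_one ht0.le]
  have hst : t ≤ ‖s - 1‖ := by
    have := Complex.abs_im_le_norm (s - 1)
    rw [Complex.sub_im, Complex.one_im, sub_zero, him] at this
    exact (le_abs_self t).trans this
  have hs1 : s - 1 ≠ 0 := norm_pos_iff.1 (ht0.trans_le hst)
  have hpoly : dirichletPoly (lineCoeff s₀ σ) t
      = ∑ k ∈ Finset.Ico 2 ⌈t⌉₊, zetaCoeff s₀ k * (k : ℂ) ^ (-s) :=
    Finset.sum_congr rfl fun k hk =>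
      lineCoeff_mul_exp s₀ σ t (by have := (Finset.mem_Ico.1 hk).1; omega)
  have heq : doubleZeta s₀ s - dirichletPoly (lineCoeff s₀ σ) t
      = doubleZetaRem s₀ ⌈t⌉₊ s / (s - 1) := by
    rw [doubleZeta_eq_doubleZetaMul_div hs₀ hα0 (by linarith) (by linarith) (hre ▸ hασ)
      (him ▸ ht0), hpoly, doubleZetaMul_eq_sum_add_rem hα0 (by linarith) (by linarith) hN
      (hre ▸ hασ)]
    field_simp
    ring
  have hrem := hC ⌈t⌉₊ s (by omega) hre ((norm_ofReal_add_mul_I_le hσ.le hσ1 ht).trans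
    (by gcongr; exact Nat.le_ceil t))
  have hpow : (⌈t⌉₊ : ℝ) ^ (1 - σ) ≤ 2 * t ^ (1 - σ) := by
    calc (⌈t⌉₊ : ℝ) ^ (1 - σ) ≤ (2 * t) ^ (1 - σ) :=
          Real.rpow_le_rpow (by positivity) hNt (by linarith)
      _ = 2 ^ (1 - σ) * t ^ (1 - σ) := Real.mul_rpow (by norm_num) ht0.le
      _ ≤ 2 ^ (1 : ℝ) * t ^ (1 - σ) := by
          gcongr
          · norm_num
          · linarith
      _ = _ := by rw [Real.rpow_one]
  rw [heq, norm_div]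
  calc _ ≤ C * (2 * t ^ (1 - σ)) / t := by
        gcongr
        exact hrem.trans (by gcongr)
    _ = _ := by
        rw [sub_eq_add_neg, Real.rpow_add ht0, Real.rpow_one]
        field_simp

lemma continuousOn_doubleZeta_line (hs₀ : 1 < s₀.re) (hσ : 0 < σ) (hσ1 : σ ≤ 1)
    (h : 2 < s₀.re + σ) :
    ContinuousOn (fun t : ℝ => doubleZeta s₀ ((σ : ℂ) + (t : ℂ) * Complex.I)) (Set.Ici 2) := by
  obtain ⟨α, hα, hασ⟩ : ∃ α, max 0 (2 - s₀.re) < α ∧ α < σ :=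
    exists_between (max_lt hσ (by linarith))
  obtain ⟨hα0, hα2⟩ := max_lt_iff.1 hα
  have hc : ContinuousOn (fun s => doubleZetaMul s₀ s / (s - 1))
      ({s : ℂ | α < s.re} ∩ {s | 0 < s.im}) :=
    (isDoubleZetaContinuation_doubleZetaMul_div hs₀ hα0 (by linarith)
      (by linarith)).differentiableOn.continuousOn
  have hm : Set.MapsTo (fun t : ℝ => (σ : ℂ) + (t : ℂ) * Complex.I) (Set.Ici 2)
      ({s : ℂ | α < s.re} ∩ {s | 0 < s.im}) := fun t ht => by
    have : (2 : ℝ) ≤ t := ht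
    constructor <;> simp <;> linarith
  refine (hc.comp (Continuous.continuousOn (by fun_prop)) hm).congr fun t ht => ?_
  exact doubleZeta_eq_doubleZetaMul_div hs₀ hα0 (by linarith) (by linarith) (hm ht).1 (hm ht).2

end CriticalStrip

lemma abs_normSq_add_sub_normSq_le (z w : ℂ) {η : ℝ} (hη : 0 < η) :
    |‖z + w‖ ^ 2 - ‖z‖ ^ 2| ≤ η * ‖z‖ ^ 2 + (1 / η + 1) * ‖w‖ ^ 2 := by
  have h1 := norm_add_le z w
  have h2 : ‖z‖ - ‖w‖ ≤ ‖z + w‖ := by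
    have := norm_sub_norm_le z (-w)
    rwa [norm_neg, sub_neg_eq_add] at this
  have h3 : 2 * ‖z‖ * ‖w‖ ≤ η * ‖z‖ ^ 2 + 1 / η * ‖w‖ ^ 2 := by
    have : η * ‖z‖ ^ 2 + 1 / η * ‖w‖ ^ 2 - 2 * ‖z‖ * ‖w‖ = (η * ‖z‖ - ‖w‖) ^ 2 / η := by
      field_simp
      ring
    have h4 : 0 ≤ (η * ‖z‖ - ‖w‖) ^ 2 / η := by positivity
    linarith
  have h5 : |‖z + w‖ ^ 2 - ‖z‖ ^ 2| ≤ 2 * ‖z‖ * ‖w‖ + ‖w‖ ^ 2 := by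
    rw [abs_le]
    constructor <;> nlinarith [norm_nonneg z, norm_nonneg w, norm_nonneg (z + w)]
  linarith

lemma integral_rpow_neg_le {c T : ℝ} (hc : 1 < c) (hT : 2 ≤ T) :
    ∫ t in (2 : ℝ)..T, t ^ (-c) ≤ 1 / (c - 1) := by
  rw [integral_rpow (Or.inr ⟨by linarith, by
    rw [Set.uIcc_of_le hT]; exact fun h => by linarith [h.1]⟩)]
  have h1 : (0 : ℝ) ≤ T ^ (-c + 1) := by positivity
  have h2 : (2 : ℝ) ^ (-c + 1) ≤ 1 :=
    Real.rpow_le_one_of_one_le_of_nonpos (by norm_num) (by linarith)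
  rw [← neg_div_neg_eq, show -(-c + 1) = c - 1 by ring]
  have : 0 < c - 1 := by linarith
  gcongr
  linarith

lemma rpow_mul_log_add_rpow_half_le {σ T : ℝ} (hσ : 1 / 2 < σ) (hT : 2 ≤ T) :
    T ^ (2 - 2 * σ) * Real.log T + T ^ (1 / 2 : ℝ) ≤ (1 / (2 * σ - 1) + 1) * T := by
  have hT0 : 0 < T := by linarith
  have h1 := Real.log_le_rpow_div hT0.le (by linarith : 0 < 2 * σ - 1)
  have h2 : T ^ (2 - 2 * σ) * T ^ (2 * σ - 1) = T := by
    rw [← Real.rpow_add hT0, show 2 - 2 * σ + (2 * σ - 1) = 1 by ring, Real.rpow_one]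
  have h3 : T ^ (1 / 2 : ℝ) ≤ T := by
    conv_rhs => rw [← Real.rpow_one T]
    exact Real.rpow_le_rpow_of_exponent_le (by linarith) (by norm_num)
  calc _ ≤ T ^ (2 - 2 * σ) * (T ^ (2 * σ - 1) / (2 * σ - 1)) + T := by gcongr
    _ = _ := by rw [← mul_div_assoc, h2]; ring

/-- A square integrable perturbation `O(t ^ (-σ))` changes the mean square of a Dirichlet
polynomial by `O(T ^ (1 / 2))`: the cross term is split with the weight `T ^ (-1 / 2)`, which plays
the role of the Cauchy–Schwarz inequality. -/
lemma exists_abs_integral_normSq_add_sub_le {b : ℕ → ℂ} {F : ℝ → ℂ} {A σ C : ℝ}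
    (hσ : 1 / 2 < σ) (hσ1 : σ ≤ 1) (hb : ∀ k, 1 ≤ k → ‖b k‖ ≤ A * (k : ℝ) ^ (-σ))
    (hF : ContinuousOn F (Set.Ici 2))
    (hE : ∀ t, 2 ≤ t → ‖F t - dirichletPoly b t‖ ≤ C * t ^ (-σ)) :
    ∃ C' : ℝ, 0 ≤ C' ∧ ∀ T : ℝ, 2 ≤ T →
      |(∫ t in (2 : ℝ)..T, ‖F t‖ ^ 2) - (∑' k : ℕ, ‖b (k + 2)‖ ^ 2) * T|
        ≤ C' * (T ^ (2 - 2 * σ) * Real.log T + T ^ (1 / 2 : ℝ)) := by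
  obtain ⟨C₁, hC₁, hS⟩ := exists_abs_integral_normSq_sub_le hσ hσ1 hb
  set D := ∑' k : ℕ, ‖b (k + 2)‖ ^ 2
  have hD : 0 ≤ D := tsum_nonneg fun k => by positivity
  have hd : 0 < 2 * σ - 1 := by linarith
  refine ⟨C₁ + (D + C₁ * (1 / (2 * σ - 1) + 1)) + 2 * (C ^ 2 * (1 / (2 * σ - 1))),
    by positivity, fun T hT => ?_⟩
  have hT0 : 0 < T := by linarith
  set X := T ^ (2 - 2 * σ) * Real.log T + T ^ (1 / 2 : ℝ) with hX
  set Y := T ^ (1 / 2 : ℝ) with hY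
  have hY1 : 1 ≤ Y := Real.one_le_rpow (by linarith) (by norm_num)
  have hY0 : 0 < Y := by linarith
  have hYX : Y ≤ X := by
    have : 0 ≤ T ^ (2 - 2 * σ) * Real.log T :=
      mul_nonneg (by positivity) (Real.log_nonneg (by linarith))
    linarith
  have hYY : Y * Y = T := by
    rw [hY, ← Real.rpow_add hT0]; norm_num
  set I := ∫ t in (2 : ℝ)..T, ‖dirichletPoly b t‖ ^ 2
  have hI : I ≤ (D + C₁ * (1 / (2 * σ - 1) + 1)) * T := by
    have h1 := (abs_le.1 (hS T hT)).2
    have h2 := mul_le_mul_of_nonneg_left (rpow_mul_log_add_rpow_half_le hσ hT) hC₁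
    linarith
  have hSi := intervalIntegrable_normSq_dirichletPoly b hT
  have hFi : IntervalIntegrable (fun t => ‖F t‖ ^ 2) MeasureTheory.volume 2 T :=
    ((hF.mono (by rw [Set.uIcc_of_le hT]; exact Set.Icc_subset_Ici_self)).norm.pow
      2).intervalIntegrable
  have hti : IntervalIntegrable (fun t : ℝ => t ^ (-(2 * σ))) MeasureTheory.volume 2 T :=
    intervalIntegral.intervalIntegrable_rpow (Or.inr (by
      rw [Set.uIcc_of_le hT]; exact fun h => by linarith [h.1]))
  have hpt : ∀ t ∈ Set.Ioc 2 T, ‖‖F t‖ ^ 2 - ‖dirichletPoly b t‖ ^ 2‖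
      ≤ 1 / Y * ‖dirichletPoly b t‖ ^ 2 + (Y + 1) * C ^ 2 * t ^ (-(2 * σ)) := by
    intro t ht
    have ht0 : 0 < t := by linarith [ht.1]
    have h1 := abs_normSq_add_sub_normSq_le (dirichletPoly b t) (F t - dirichletPoly b t)
      (one_div_pos.2 hY0)
    rw [add_sub_cancel, one_div_one_div] at h1
    have h2 : ‖F t - dirichletPoly b t‖ ^ 2 ≤ C ^ 2 * t ^ (-(2 * σ)) := by
      calc _ ≤ (C * t ^ (-σ)) ^ 2 := by
            gcongr
            exact hE t ht.1.le
        _ = _ := by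
            rw [mul_pow, ← Real.rpow_natCast (t ^ (-σ)), ← Real.rpow_mul ht0.le]
            congr 2
            push_cast
            ring
    rw [Real.norm_eq_abs]
    refine h1.trans ?_
    rw [mul_assoc (Y + 1)]
    gcongr
  have hdiff : |(∫ t in (2 : ℝ)..T, ‖F t‖ ^ 2) - I|
      ≤ 1 / Y * I + (Y + 1) * C ^ 2 * ∫ t in (2 : ℝ)..T, t ^ (-(2 * σ)) := by
    rw [← intervalIntegral.integral_sub hFi hSi, ← intervalIntegral.integral_const_mul,
      ← intervalIntegral.integral_const_mul,
      ← intervalIntegral.integral_add (hSi.const_mul _) (hti.const_mul _), ← Real.norm_eq_abs]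
    exact intervalIntegral.norm_integral_le_of_norm_le hT
      (Eventually.of_forall hpt) ((hSi.const_mul _).add (hti.const_mul _))
  have h1 : 1 / Y * I ≤ (D + C₁ * (1 / (2 * σ - 1) + 1)) * Y := by
    calc _ ≤ 1 / Y * ((D + C₁ * (1 / (2 * σ - 1) + 1)) * T) := by gcongr
      _ = _ := by rw [← hYY]; field_simp
  have h2 : (Y + 1) * C ^ 2 * ∫ t in (2 : ℝ)..T, t ^ (-(2 * σ))
      ≤ 2 * (C ^ 2 * (1 / (2 * σ - 1))) * Y := by
    calc _ ≤ (2 * Y) * C ^ 2 * (1 / (2 * σ - 1)) := by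
          refine mul_le_mul ?_ (integral_rpow_neg_le (by linarith) hT) ?_ (by positivity)
          · gcongr; linarith
          · exact intervalIntegral.integral_nonneg hT fun t ht => by
              have : 0 ≤ t := by linarith [ht.1]
              positivity
      _ = _ := by ring
  have h3 : (D + C₁ * (1 / (2 * σ - 1) + 1)) * Y + 2 * (C ^ 2 * (1 / (2 * σ - 1))) * Y
      ≤ (D + C₁ * (1 / (2 * σ - 1) + 1)) * X + 2 * (C ^ 2 * (1 / (2 * σ - 1))) * X := by
    gcongr
  calc _ ≤ |(∫ t in (2 : ℝ)..T, ‖F t‖ ^ 2) - I| + |I - D * T| := abs_sub_le _ _ _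
    _ ≤ _ := add_le_add hdiff (hS T hT)
    _ ≤ _ := by linarith

/-- A quantity that is `O(f + g)` splits, in proportion to `f` and `g`, into `O(f)` and `O(g)`. -/
lemma exists_isBigO_add_isBigO {J f g : ℝ → ℝ} {C a : ℝ} (hf : ∀ T, a ≤ T → 0 ≤ f T)
    (hg : ∀ T, a ≤ T → 0 < g T) (hJ : ∀ T, a ≤ T → |J T| ≤ C * (f T + g T)) :
    ∃ E₁ E₂ : ℝ → ℝ, E₁ =O[atTop] f ∧ E₂ =O[atTop] g ∧ ∀ T, a ≤ T → J T = E₁ T + E₂ T := by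
  have key : ∀ T, a ≤ T → |J T / (f T + g T)| ≤ C := fun T hT => by
    have h0 : 0 < f T + g T := add_pos_of_nonneg_of_pos (hf T hT) (hg T hT)
    rw [abs_div, abs_of_pos h0, div_le_iff₀ h0]
    exact hJ T hT
  refine ⟨fun T => J T / (f T + g T) * f T, fun T => J T / (f T + g T) * g T, ?_, ?_, ?_⟩
  · refine IsBigO.of_bound C ?_
    filter_upwards [eventually_ge_atTop a] with T hT
    rw [norm_mul]
    exact mul_le_mul_of_nonneg_right (key T hT) (norm_nonneg _)
  · refine IsBigO.of_bound C ?_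
    filter_upwards [eventually_ge_atTop a] with T hT
    rw [norm_mul]
    exact mul_le_mul_of_nonneg_right (key T hT) (norm_nonneg _)
  · intro T hT
    have h0 : f T + g T ≠ 0 := (add_pos_of_nonneg_of_pos (hf T hT) (hg T hT)).ne'
    rw [← mul_add, div_mul_cancel₀ _ h0]

theorem theorem1p2 (s₀ : ℂ) (σ : ℝ) (hs₀ : 1 < s₀.re) (hσ : 1 / 2 < σ) (hσ' : σ ≤ 1)
    (hsum : 2 < s₀.re + σ) :
    Summable (fun k : ℕ => doubleZetaSqTerm s₀ (2 * σ) (k + 2)) ∧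
    ContinuousOn (fun t : ℝ => doubleZeta s₀ ((σ : ℂ) + (t : ℂ) * Complex.I)) (Set.Ici 2) ∧
    ∃ E₁ E₂ : ℝ → ℝ,
      (E₁ =O[atTop] fun T : ℝ => T ^ (2 - 2 * σ) * Real.log T) ∧
      (E₂ =O[atTop] fun T : ℝ => T ^ (1 / 2 : ℝ)) ∧
      ∀ T : ℝ, 2 ≤ T →
        ∫ t in (2 : ℝ)..T, ‖doubleZeta s₀ ((σ : ℂ) + (t : ℂ) * Complex.I)‖ ^ 2
          = doubleZetaSq s₀ (2 * σ) * T + E₁ T + E₂ T := by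
  obtain ⟨A, hA⟩ := exists_norm_zetaCoeff_le hs₀
  have hb : ∀ k, 1 ≤ k → ‖lineCoeff s₀ σ k‖ ≤ A * (k : ℝ) ^ (-σ) := fun k hk => by
    rw [norm_lineCoeff s₀ σ hk]
    exact mul_le_mul_of_nonneg_right (hA k) (by positivity)
  have hterm : ∀ k : ℕ, doubleZetaSqTerm s₀ (2 * σ) (k + 2) = ‖lineCoeff s₀ σ (k + 2)‖ ^ 2 :=
    fun k => doubleZetaSqTerm_eq_normSq s₀ σ (by omega)
  have hcont := continuousOn_doubleZeta_line hs₀ (by linarith) hσ' hsum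
  obtain ⟨C, -, hC⟩ :=
    exists_norm_doubleZeta_sub_dirichletPoly_le hs₀ (by linarith) hσ' hsum
  obtain ⟨C', -, hC'⟩ := exists_abs_integral_normSq_add_sub_le hσ hσ' hb hcont hC
  refine ⟨by simpa only [hterm] using summable_normSq_coeff hσ hb, hcont, ?_⟩
  obtain ⟨E₁, E₂, h₁, h₂, hE⟩ := exists_isBigO_add_isBigO (a := 2)
    (fun T hT => mul_nonneg (Real.rpow_nonneg (by linarith) _) (Real.log_nonneg (by linarith)))
    (fun T hT => Real.rpow_pos_of_pos (by linarith) _) hC'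
  refine ⟨E₁, E₂, h₁, h₂, fun T hT => ?_⟩
  have hD : doubleZetaSq s₀ (2 * σ) = ∑' k : ℕ, ‖lineCoeff s₀ σ (k + 2)‖ ^ 2 := tsum_congr hterm
  rw [hD]
  linarith [hE T hT]
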